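/- **Setting.** Let $Q$ be a smooth (finite-dimensional, Hausdorff) manifold and let $A\to Q$ be a Lie algebroid: a smooth real vector bundle of finite rank with a Lie bracket $[\cdot,\cdot]$ on $\Gamma(A)$ and an anchor, i.e. a smooth bundle map $\rho\colon A\to TQ$, such that $[X,fY]=\rho(X)[f]\,Y+f[X,Y]$ for $X,Y\in\Gamma(A)$, $f\in C^\infty(Q)$. Let $\pi\colon A^*\to Q$ be the dual bundle. * For a smooth vector bundle $V\to Q$, an $A$-connection on $V$ is an $\mathbb R$-bilinear map $\Gamma(A)\times\Gamma(V)\to\Gamma(V)$, $(X,s)\mapsto\nabla_Xs$, with $\nabla_{fX}s=f\nabla_Xs$ and $\nabla_X(fs)=\rho(X)[f]\,s+f\nabla_Xs$. Its dual $\nabla^*$ is the $A$-connection on $V^*$ given by $\langle\nabla^*_X\sigma,s\rangle=\rho(X)[\langle\sigma,s\rangle]-\langle\sigma,\nabla_Xs\rangle$. A $TQ$-connection is an ordinary linear connection. * A $TQ$-connection $\nabla$ on $A$ induces the $A$-connection $\overline\nabla$ on $A$ given by $\overline\nabla_XY=\nabla_{\rho(Y)}X+[X,Y]$. * A curve $a$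 in $A$ over a base path $q\colon J\to Q$ is an $A$-path if $\dot q(t)=\rho(a(t))$ for all $t\in J$. Given an $A$-connection $\nabla$ on $V$, an $A$-path $a$ over $q$, and a path $u$ in $V$ over $q$, set $$\nabla_au(t)=\partial_t\eta(t,q(t))+\nabla_\xi\eta(t,q(t)),$$ where $\xi$ and $\eta$ are time-dependent sections of $A$ and $V$ with $\xi(t,q(t))=a(t)$ and $\eta(t,q(t))=u(t)$; this does not depend on the choice of $\xi$ and $\eta$. * For $p\in A^*_q$ and $r\in A_q^*$, let $V_pr=\frac{d}{d\epsilon}\big|_{\epsilon=0}(p+\epsilon r)\in T_pA^*$. Given a $TQ$-connection $\nabla$ on $A$ with dual connection $\nabla^*$ on $A^*$, let $H_pv=T\mu(v)-V_p(\nabla^*_v\mu)\in T_pA^*$ for $v\in T_qQ$, where $\mu\in\Gamma(A^*)$ is any section with $\mu(q)=p$. For $\alpha\in T_p^*A^*$, define $\alpha^{\mathrm{ver}}\in A_q$ and $\alpha^{\mathrm{hor}}\in T_q^*Q$ by $\langle r,\alpha^{\mathrm{ver}}\rangle=\langle\alpha,V_pr\rangle$ and $\langle\alpha^{\mathrm{hor}},v\rangle=\langle\alpha,H_pv\rangle$.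 For $H\in C^\infty(A^*)$ write $\mathrm dH^{\mathrm{ver}}(p)=(\mathrm dH(p))^{\mathrm{ver}}$ and $\mathrm dH^{\mathrm{hor}}(p)=(\mathrm dH(p))^{\mathrm{hor}}$. * For $X\in\Gamma(A)$ let $\Phi_X\in C^\infty(A^*)$, $\Phi_X(p)=\langle p,X\rangle$. The $(\pm)$ Lie–Poisson bracket on $C^\infty(A^*)$ is the unique Poisson bracket with $\{\Phi_X,\Phi_Y\}_\pm=\pm\Phi_{[X,Y]}$; it satisfies $\{\Phi_X,g\circ\pi\}_\pm=\pm\rho(X)[g]\circ\pi$ and $\{f\circ\pi,g\circ\pi\}_\pm=0$. The Hamiltonian vector field $X_H$ of $H$ is determined by $X_H[F]=\{F,H\}_\pm$ for all $F\in C^\infty(A^*)$. **Theorem.** Let $\nabla$ be a $TQ$-connection on $A$, let $H\in C^\infty(A^*)$, fix one of the two signs, and let $p\colon J\to A^*$ be a $C^1$ path on a nondegenerate interval $J\subseteq\mathbb R$ (one-sided derivatives at endpoints in $J$), with base path $q=\pi\circ p$. Put $a(t)=\mp\,\mathrm dH^{\mathrm{ver}}(p(t))\in A_{q(t)}$. Then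 $p$ is an integral curve of the Hamiltonian vector field of $H$ with respect to the $(\pm)$ Lie–Poisson structure if and only if $$\dot q=\rho(a)\qquad\text{and}\qquad\overline\nabla{}^*_a\,p=\pm\,\rho^*\bigl(\mathrm dH^{\mathrm{hor}}(p)\bigr)$$ on $J$. The first equation says that $a$ is an $A$-path over $q$, so that the covariant derivative $\overline\nabla{}^*_ap$ along $a$, formed with the dual $\overline\nabla{}^*$ of $\overline\nabla$, makes sense. -/

import Mathlib

open Bundle Manifold ContDiff Topology Set

noncomputable section
set_option linter.unusedSectionVars false
namespace LiePoisson

/-- The dual bundle `V*`, with fibres `V_q* = Hom(V_q, ℝ)`. -/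
abbrev DualBundle {Q : Type*} (V : Q → Type*) [∀ q, AddCommGroup (V q)] [∀ q, Module ℝ (V q)]
    [∀ q, TopologicalSpace (V q)] (q : Q) : Type _ :=
  V q →L[ℝ] Bundle.Trivial Q ℝ q

/-- The duality pairing `⟨φ, w⟩` between `V*` and `V`. -/
abbrev pair {Q : Type*} {V : Q → Type*} [∀ q, AddCommGroup (V q)] [∀ q, Module ℝ (V q)]
    [∀ q, TopologicalSpace (V q)] {q : Q} (φ : DualBundle V q) (w : V q) : ℝ := φ w

section Sections
variable {E : Type*} [NormedAddCommGroup E] [NormedSpace ℝ E]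
  {Q : Type*} [TopologicalSpace Q] [ChartedSpace E Q]
  {G : Type*} [NormedAddCommGroup G] [NormedSpace ℝ G]
  {V : Q → Type*} [TopologicalSpace (TotalSpace G V)]
  [∀ q, AddCommGroup (V q)] [∀ q, Module ℝ (V q)] [∀ q, TopologicalSpace (V q)]
  [FiberBundle G V] [VectorBundle ℝ G V]

variable (E G V) in
/-- The space `Γ(V)` of smooth sections of a vector bundle `V → Q` with model fibre `G`. -/
abbrev Sec := Cₛ^∞⟮𝓘(ℝ, E); G, V⟯

variable (E Q) in
/-- The ring `C^∞(Q)` of smooth real functions on `Q`. -/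
abbrev Fn := C^∞⟮𝓘(ℝ, E), Q; ℝ⟯

/-- The product `f s` of a function and a section. -/
def mulSec (f : Fn E Q) (s : Sec E G V) : Sec E G V :=
  ⟨fun q => f q • s q, f.contMDiff.smul_section s.contMDiff⟩

@[simp] theorem mulSec_apply (f : Fn E Q) (s : Sec E G V) (q : Q) : mulSec f s q = f q • s q := rfl

/-- The function `⟨σ, s⟩` on `Q`, for sections `σ` of `V*` and `s` of `V`. -/
def pairing [IsManifold 𝓘(ℝ, E) ∞ Q] [ContMDiffVectorBundle ∞ G V 𝓘(ℝ, E)]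
    (σ : Sec E (G →L[ℝ] ℝ) (DualBundle V)) (s : Sec E G V) : Fn E Q :=
  ⟨fun q => σ q (s q), by
    have h := σ.contMDiff.clm_bundle_apply (F₂ := ℝ) (E₂ := Bundle.Trivial Q ℝ) s.contMDiff
    intro q
    exact (contMDiffAt_totalSpace.1 (h q)).2⟩

@[simp] theorem pairing_apply [IsManifold 𝓘(ℝ, E) ∞ Q] [ContMDiffVectorBundle ∞ G V 𝓘(ℝ, E)]
    (σ : Sec E (G →L[ℝ] ℝ) (DualBundle V)) (s : Sec E G V) (q : Q) :
    pairing σ s q = σ q (s q) := rfl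

variable [FiniteDimensional ℝ E] [T2Space Q] [IsManifold 𝓘(ℝ, E) ∞ Q]
   [ContMDiffVectorBundle ∞ G V 𝓘(ℝ, E)]

theorem exists_bump {q : Q} {u : Set Q} (hu : u ∈ 𝓝 q) :
    ∃ f : SmoothBumpFunction 𝓘(ℝ, E) q, tsupport f ⊆ u := by
  obtain ⟨f, -, hf⟩ := (SmoothBumpFunction.nhds_basis_tsupport (I := 𝓘(ℝ, E)) q).mem_iff.1 hu
  exact ⟨f, hf⟩


variable (E) in
/-- There is a global section which, near `q`, is constant in the trivialization at `q`. -/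
theorem exists_section_const (q : Q) (g : G) :
    ∃ s : Sec E G V, ∀ᶠ x in 𝓝 q, s x = (trivializationAt G V q).symm x g := by
  set e := trivializationAt G V q
  have hq : q ∈ e.baseSet := FiberBundle.mem_baseSet_trivializationAt G V q
  obtain ⟨f, hf⟩ := exists_bump (E := E) (e.open_baseSet.mem_nhds hq)
  have hs : ContMDiffOn 𝓘(ℝ, E) (𝓘(ℝ, E).prod 𝓘(ℝ, G)) ∞
      (fun x => TotalSpace.mk' G x (e.symm x g)) e.baseSet := by
    rw [e.contMDiffOn_section_baseSet_iff]
    apply (contMDiffOn_const (c := g)).congr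
    intro y hy
    rw [e.apply_mk_symm hy]
  refine ⟨⟨_, ContMDiffOn.smul_section_of_tsupport (f.contMDiff.contMDiffOn) e.open_baseSet hf hs⟩, ?_⟩
  filter_upwards [f.eventuallyEq_one] with x hx
  simp [hx]

variable (E G) in
theorem exists_section_through (q : Q) (w : V q) : ∃ s : Sec E G V, s q = w := by
  obtain ⟨s, hs⟩ := exists_section_const E (V := V) q (trivializationAt G V q ⟨q, w⟩).2
  refine ⟨s, ?_⟩
  rw [hs.self_of_nhds]
  exact (trivializationAt G V q).symm_apply_apply_mk (FiberBundle.mem_baseSet_trivializationAt G V q) w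

variable [FiniteDimensional ℝ G]

/-- A `C^∞(Q)`-linear (at `q`) map on sections vanishes on sections vanishing at `q`. -/
theorem tensorial_eq_zero {W : Type*} [AddCommGroup W] [Module ℝ W] {q : Q} (D : Sec E G V → W)
    (hadd : ∀ s t, D (s + t) = D s + D t) (hmul : ∀ f s, D (mulSec f s) = f q • D s)
    (s : Sec E G V) (hs : s q = 0) : D s = 0 := by
  set e := trivializationAt G V q
  have hq : q ∈ e.baseSet := FiberBundle.mem_baseSet_trivializationAt G V q
  obtain ⟨f, hf⟩ := exists_bump (E := E) (e.open_baseSet.mem_nhds hq)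
  let b := Module.finBasis ℝ G
  let F₁ : Fn E Q := ⟨f, f.contMDiff⟩
  have : ContMDiffVectorBundle 1 G V 𝓘(ℝ, E) := ContMDiffVectorBundle.of_le (n := ∞) (by simp)
  let c : Fin (Module.finrank ℝ G) → Fn E Q := fun i =>
    ⟨fun x => f x • LinearMap.piApply (e.localFrameCoeff 𝓘(ℝ, E) b i) s x, by
      refine contMDiff_of_tsupport fun x hx => ?_
      have hx' : x ∈ e.baseSet := hf (tsupport_smul_subset_left _ _ hx)
      exact (f.contMDiff x).smul (contMDiffAt_localFrameCoeff b hx' (s.contMDiff x) i)⟩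
  let t : Fin (Module.finrank ℝ G) → Sec E G V := fun i =>
    ⟨_, ContMDiffOn.smul_section_of_tsupport (f.contMDiff.contMDiffOn) e.open_baseSet hf
      (e.contMDiffOn_localFrame_baseSet ∞ b i)⟩
  have hc : ∀ i x, c i x = f x * e.localFrameCoeff 𝓘(ℝ, E) b i x (s x) := fun i x => rfl
  have ht : ∀ i x, t i x = f x • e.localFrame b i x := fun i x => rfl
  have h0 : D 0 = 0 := by simpa using hadd 0 0
  have hsum : ∀ u : Finset (Fin (Module.finrank ℝ G)),
      D (∑ i ∈ u, mulSec (c i) (t i)) = ∑ i ∈ u, D (mulSec (c i) (t i)) := by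
    intro u
    induction u using Finset.induction_on with
    | empty => simpa using h0
    | insert a u ha ih => rw [Finset.sum_insert ha, Finset.sum_insert ha, hadd, ih]
  have key : mulSec F₁ (mulSec F₁ s) = ∑ i, mulSec (c i) (t i) := by
    ext x
    have : (∑ i, mulSec (c i) (t i)) x = ∑ i, (mulSec (c i) (t i)) x := by
      have := congrFun (map_sum (ContMDiffSection.coeAddHom 𝓘(ℝ, E) G ∞ V)
        (fun i => mulSec (c i) (t i)) Finset.univ) x
      rw [Finset.sum_apply] at this
      exact this
    rw [this]
    by_cases hx : x ∈ e.baseSet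
    · conv_lhs => rw [mulSec_apply, mulSec_apply, e.eq_sum_localFrameCoeff_smul (I := 𝓘(ℝ, E)) (b := b) (s := s) hx]
      rw [Finset.smul_sum, Finset.smul_sum]
      refine Finset.sum_congr rfl fun i _ => ?_
      rw [mulSec_apply, hc, ht, smul_smul, smul_smul, smul_smul]
      congr 1
      change f x * f x * _ = _
      ring
    · have : f x = 0 := image_eq_zero_of_notMem_tsupport fun h => hx (hf h)
      have h2 : F₁ x = 0 := this
      rw [mulSec_apply, h2, zero_smul]
      symm
      refine Finset.sum_eq_zero fun i _ => ?_
      rw [mulSec_apply, hc, this, zero_mul, zero_smul]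
  have h1 : D (mulSec F₁ (mulSec F₁ s)) = D s := by
    have : F₁ q = 1 := f.eq_one
    rw [hmul, hmul, this, one_smul, one_smul]
  rw [← h1, key, hsum]
  refine Finset.sum_eq_zero fun i _ => ?_
  rw [hmul]
  have : c i q = 0 := by
    rw [hc, hs, map_zero, mul_zero]
  rw [this, zero_smul]

theorem exists_functional {q : Q} (D : Sec E G V → ℝ)
    (hadd : ∀ s t, D (s + t) = D s + D t) (hmul : ∀ f s, D (mulSec f s) = f q * D s) :
    ∃ φ : DualBundle V q, ∀ s : Sec E G V, pair φ (s q) = D s := by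
  have : T2Space (V q) := FiberBundle.t2Space G V q
  have : FiniteDimensional ℝ (V q) := VectorBundle.finiteDimensional ℝ G V q
  have : IsTopologicalAddGroup (V q) :=
    (VectorBundle.continuousLinearEquivAt ℝ G V q).toContinuousAddEquiv.isTopologicalAddGroup
  have : ContinuousSMul ℝ (V q) :=
    (VectorBundle.continuousLinearEquivAt ℝ G V q).continuousSMul
  choose ext hext using exists_section_through E G (V := V) q
  have hconst : ∀ (r : ℝ) (s : Sec E G V), D (r • s) = r * D s := fun r s =>
    hmul (ContMDiffMap.const r) s
  have hsub : ∀ s t : Sec E G V, D (s - t) = D s - D t := fun s t => by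
    have := hadd (s - t) t
    rw [sub_add_cancel] at this
    linarith
  have hpt : ∀ s t : Sec E G V, s q = t q → D s = D t := fun s t h => by
    have := tensorial_eq_zero (q := q) D hadd hmul (s - t) (by simp [h])
    rw [hsub] at this
    linarith
  refine ⟨LinearMap.toContinuousLinearMap (E := V q) (F' := ℝ)
    { toFun := fun w => D (ext w), map_add' := fun v w => ?_, map_smul' := fun r w => ?_ },
    fun s => hpt _ _ (hext _)⟩
  · rw [← hadd]; exact hpt _ _ (by simp [hext])
  · rw [RingHom.id_apply, smul_eq_mul, ← hconst]; exact hpt _ _ (by simp [hext])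

/-- Smoothness of a section of the dual bundle can be tested on sections. -/
theorem contMDiff_dual (σ : ∀ q, DualBundle V q)
    (h : ∀ s : Sec E G V, ContMDiff 𝓘(ℝ, E) 𝓘(ℝ) ∞ (fun q => (pair (σ q) (s q)))) :
    ContMDiff 𝓘(ℝ, E) (𝓘(ℝ, E).prod 𝓘(ℝ, G →L[ℝ] ℝ)) ∞
      (fun q => TotalSpace.mk' (G →L[ℝ] ℝ) (E := DualBundle V) q (σ q)) := by
  intro q
  rw [contMDiffAt_hom_bundle]
  refine ⟨contMDiffAt_id, ?_⟩
  let b := Module.finBasis ℝ G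
  choose s hs using fun i => exists_section_const E (V := V) q (b i)
  have hs' := Filter.eventually_all.2 hs
  have hsm : ContMDiffAt 𝓘(ℝ, E) 𝓘(ℝ, G →L[ℝ] ℝ) ∞ (fun x => ∑ i,
      (pair (σ x) (s i x)) • LinearMap.toContinuousLinearMap (b.coord i)) q := by
    apply ContMDiffAt.sum
    intro i _
    exact (h (s i) q).smul contMDiffAt_const
  refine hsm.congr_of_eventuallyEq ?_
  filter_upwards [hs', (trivializationAt G V q).open_baseSet.mem_nhds
    (FiberBundle.mem_baseSet_trivializationAt G V q)] with x hx hxb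
  apply ContinuousLinearMap.coe_injective
  refine b.ext fun j => ?_
  simp [ContinuousLinearMap.inCoordinates, Finsupp.single_apply, hx,
    (trivializationAt G V q).symmL_apply hxb]
end Sections

section Algebroid
variable {E : Type*} [NormedAddCommGroup E] [NormedSpace ℝ E]
  {Q : Type*} [TopologicalSpace Q] [ChartedSpace E Q] [IsManifold 𝓘(ℝ, E) ∞ Q]
  {F : Type*} [NormedAddCommGroup F] [NormedSpace ℝ F]
  {A : Q → Type*} [TopologicalSpace (TotalSpace F A)]
  [∀ q, AddCommGroup (A q)] [∀ q, Module ℝ (A q)] [∀ q, TopologicalSpace (A q)]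
  [FiberBundle F A] [VectorBundle ℝ F A] [ContMDiffVectorBundle ∞ F A 𝓘(ℝ, E)]
  {G : Type*} [NormedAddCommGroup G] [NormedSpace ℝ G]
  {V : Q → Type*} [TopologicalSpace (TotalSpace G V)]
  [∀ q, AddCommGroup (V q)] [∀ q, Module ℝ (V q)] [∀ q, TopologicalSpace (V q)]
  [FiberBundle G V] [VectorBundle ℝ G V] [ContMDiffVectorBundle ∞ G V 𝓘(ℝ, E)]

/-- The derivative `v[f] = ⟨df(q), v⟩` of `f ∈ C^∞(Q)` along a tangent vector `v` at `q`. -/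
def dirDeriv {q : Q} (v : TangentSpace 𝓘(ℝ, E) q) (f : Fn E Q) : ℝ := mvfderiv 𝓘(ℝ, E) f q v

variable (E F A) in
/-- A Lie algebroid structure on the smooth vector bundle `A → Q`: a Lie bracket on `Γ(A)`
(`ℝ`-bilinear, alternating, with the Jacobi identity) and a smooth vector bundle map, the anchor
`ρ : A → TQ`, related by the Leibniz rule `[X, f Y] = ρ(X)[f] Y + f [X, Y]`. -/
structure LieAlgebroid where
  bracket : Sec E F A →ₗ[ℝ] Sec E F A →ₗ[ℝ] Sec E F A
  anchor : Cₛ^∞⟮𝓘(ℝ, E); F →L[ℝ] E, fun q : Q => A q →L[ℝ] TangentSpace 𝓘(ℝ, E) q⟯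
  bracket_self : ∀ X, bracket X X = 0
  jacobi : ∀ X Y Z, bracket X (bracket Y Z) = bracket (bracket X Y) Z + bracket Y (bracket X Z)
  leibniz : ∀ (f : Fn E Q) (X Y : Sec E F A) (q : Q), bracket X (mulSec f Y) q =
    dirDeriv (anchor q (X q)) f • Y q + f q • bracket X Y q

variable (G V) in
/-- An `A`-connection on the vector bundle `V → Q`: an `ℝ`-bilinear map
`Γ(A) × Γ(V) → Γ(V)`, `(X, s) ↦ ∇_X s`, which is `C^∞(Q)`-linear in `X` and satisfies
`∇_X (f s) = ρ(X)[f] s + f ∇_X s`. -/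
structure AConnection (L : LieAlgebroid E F A) where
  toFun : Sec E F A →ₗ[ℝ] Sec E G V →ₗ[ℝ] Sec E G V
  mul_left : ∀ (f : Fn E Q) (X : Sec E F A) (s : Sec E G V) (q : Q),
    toFun (mulSec f X) s q = f q • toFun X s q
  leibniz : ∀ (f : Fn E Q) (X : Sec E F A) (s : Sec E G V) (q : Q),
    toFun X (mulSec f s) q = dirDeriv (L.anchor q (X q)) f • s q + f q • toFun X s q

variable [FiniteDimensional ℝ E] [T2Space Q] [FiniteDimensional ℝ G]

theorem fn_mdiff (f : Fn E Q) (q : Q) : MDifferentiableAt 𝓘(ℝ, E) 𝓘(ℝ) f q :=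
  f.contMDiff.mdifferentiable (by simp) q

theorem dirDeriv_add {q : Q} (v : TangentSpace 𝓘(ℝ, E) q) (f g : Fn E Q) :
    dirDeriv v (f + g) = dirDeriv v f + dirDeriv v g := by
  have := mvfderiv_add (fn_mdiff f q) (fn_mdiff g q)
  exact congrArg (fun l => l v) this

theorem dirDeriv_const {q : Q} (v : TangentSpace 𝓘(ℝ, E) q) (r : ℝ) :
    dirDeriv v (ContMDiffMap.const r) = 0 := by
  have : mvfderiv 𝓘(ℝ, E) (fun _ : Q => r) q = 0 := mvfderiv_const r
  exact congrArg (fun l => l v) this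

theorem dirDeriv_mul {q : Q} (v : TangentSpace 𝓘(ℝ, E) q) (f g : Fn E Q) :
    dirDeriv v (f * g) = f q * dirDeriv v g + g q * dirDeriv v f := by
  have := mvfderiv_mul (fn_mdiff f q) (fn_mdiff g q)
  exact congrArg (fun l => l v) this

theorem pairing_mulSec (σ : Sec E (G →L[ℝ] ℝ) (DualBundle V)) (f : Fn E Q) (s : Sec E G V) :
    pairing σ (mulSec f s) = f * pairing σ s := by
  ext x; exact (σ x).map_smul (f x) (s x)

theorem pairing_add (σ : Sec E (G →L[ℝ] ℝ) (DualBundle V)) (s t : Sec E G V) :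
    pairing σ (s + t) = pairing σ s + pairing σ t := by
  ext x; exact (σ x).map_add (s x) (t x)

theorem exists_dual {q : Q} (v : TangentSpace 𝓘(ℝ, E) q) (D : Sec E G V → V q)
    (hadd : ∀ s t, D (s + t) = D s + D t)
    (hmul : ∀ f s, D (mulSec f s) = dirDeriv v f • s q + f q • D s)
    (σ : Sec E (G →L[ℝ] ℝ) (DualBundle V)) :
    ∃ φ : DualBundle V q, ∀ s : Sec E G V,
      pair φ (s q) = dirDeriv v (pairing σ s) - (pair (σ q) (D s)) := by
  refine exists_functional (fun s => dirDeriv v (pairing σ s) - (pair (σ q) (D s))) ?_ ?_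
  · intro s t
    have : (pair (σ q) (D s + D t)) = (pair (σ q) (D s)) + (pair (σ q) (D t)) :=
      (σ q).map_add _ _
    simp only [pairing_add, dirDeriv_add, hadd, this]; ring
  · intro f s
    have : (pair (σ q) (dirDeriv v f • s q + f q • D s))
        = dirDeriv v f * (pairing σ s q) + f q * (pair (σ q) (D s)) := by
      refine ((σ q).map_add _ _).trans ?_
      exact congrArg₂ (· + ·) ((σ q).map_smul _ _) ((σ q).map_smul _ _)
    simp only [pairing_mulSec, dirDeriv_mul, hmul, this]; ring

theorem dual_ext {q : Q} {φ ψ : DualBundle V q} (h : ∀ s : Sec E G V, pair φ (s q) = pair ψ (s q)) : φ = ψ := by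
  ext w
  obtain ⟨s, rfl⟩ := exists_section_through E G q w
  exact h s

namespace AConnection
variable {L : LieAlgebroid E F A} (D : AConnection G V L)

theorem exists_dualFun (X : Sec E F A) (σ : Sec E (G →L[ℝ] ℝ) (DualBundle V)) (q : Q) :
    ∃ φ : DualBundle V q, ∀ s : Sec E G V,
      pair φ (s q) = dirDeriv (L.anchor q (X q)) (pairing σ s) - (pair (σ q) (D.toFun X s q)) :=
  exists_dual _ (fun s => D.toFun X s q) (fun s t => by simp) (fun f s => D.leibniz f X s q) σ

/-- The value `(∇*_X σ)(q)` of the dual connection, characterized by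
`⟨∇*_X σ, s⟩ = ρ(X)[⟨σ, s⟩] - ⟨σ, ∇_X s⟩` for all sections `s`. -/
def dualFun (X : Sec E F A) (σ : Sec E (G →L[ℝ] ℝ) (DualBundle V)) (q : Q) : DualBundle V q :=
  (D.exists_dualFun X σ q).choose

theorem dualFun_apply (X : Sec E F A) (σ : Sec E (G →L[ℝ] ℝ) (DualBundle V)) (q : Q)
    (s : Sec E G V) : (pair (D.dualFun X σ q) (s q)) =
      dirDeriv (L.anchor q (X q)) (pairing σ s) - (pair (σ q) (D.toFun X s q)) :=
  (D.exists_dualFun X σ q).choose_spec s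

theorem contMDiff_dirDeriv_anchor (L : LieAlgebroid E F A) (X : Sec E F A) (f : Fn E Q) :
    ContMDiff 𝓘(ℝ, E) 𝓘(ℝ) ∞ (fun q => dirDeriv (L.anchor q (X q)) f) := by
  have h := L.anchor.contMDiff.clm_bundle_apply X.contMDiff
  have h2 := f.contMDiff.contMDiff_tangentMap (m := ∞) (by simp)
  have h3 := h2.comp h
  exact (contMDiff_snd_tangentBundle_modelSpace ℝ 𝓘(ℝ, ℝ)).comp h3

theorem dualFun_mul_left (f : Fn E Q) (X : Sec E F A)
  (σ : Sec E (G →L[ℝ] ℝ) (DualBundle V)) (q : Q) :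
  D.dualFun (mulSec f X) σ q = f q • D.dualFun X σ q := by
  refine dual_ext (E := E) (G := G) fun s => ?_
  have h1 := D.dualFun_apply (mulSec f X) σ q s
  have h2 := D.dualFun_apply X σ q s
  have h4 : (pair (σ q) (D.toFun (mulSec f X) s q)) =
      f q * (pair (σ q) (D.toFun X s q)) := by
    rw [D.mul_left]; exact (σ q).map_smul _ _
  have h5 : dirDeriv (L.anchor q ((mulSec f X) q)) (pairing σ s) =
      f q * dirDeriv (L.anchor q (X q)) (pairing σ s) := by
    rw [mulSec_apply, map_smul]; exact map_smul _ _ _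
  refine h1.trans ?_
  rw [h4, h5, ← mul_sub]
  exact congrArg (f q * ·) h2.symm

theorem dualFun_leibniz (f : Fn E Q) (X : Sec E F A)
    (σ : Sec E (G →L[ℝ] ℝ) (DualBundle V)) (q : Q) :
    D.dualFun X (mulSec f σ) q =
      dirDeriv (L.anchor q (X q)) f • σ q + f q • D.dualFun X σ q := by
    refine dual_ext (E := E) (G := G) fun s => ?_
    have h1 := D.dualFun_apply X (mulSec f σ) q s
    have h2 := D.dualFun_apply X σ q s
    have h5 : dirDeriv (L.anchor q (X q)) (pairing (mulSec f σ) s) =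
        f q * dirDeriv (L.anchor q (X q)) (pairing σ s) +
          (pair (σ q) (s q)) * dirDeriv (L.anchor q (X q)) f :=
      dirDeriv_mul (L.anchor q (X q)) f (pairing σ s)
    have h4 : (pair ((mulSec f σ) q) (D.toFun X s q)) =
        f q * (pair (σ q) (D.toFun X s q)) := rfl
    have h6 : (pair ((dirDeriv (L.anchor q (X q)) f • σ q + f q • D.dualFun X σ q)) (s q)) =
        dirDeriv (L.anchor q (X q)) f * (pair (σ q) (s q)) +
          f q * (pair (D.dualFun X σ q) (s q)) := rfl
    refine h1.trans (Eq.trans ?_ h6.symm)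
    rw [h2, h4, h5]
    ring

/-- The dual `A`-connection `∇*` on `V*`: `⟨∇*_X σ, s⟩ = ρ(X)[⟨σ, s⟩] - ⟨σ, ∇_X s⟩`. -/
def dual : AConnection (G →L[ℝ] ℝ) (DualBundle V) L where
  toFun := LinearMap.mk₂ ℝ (fun X σ => ⟨D.dualFun X σ, contMDiff_dual _ fun s => by
      simp only [D.dualFun_apply]
      exact (contMDiff_dirDeriv_anchor L X _).sub (pairing σ (D.toFun X s)).contMDiff⟩)
    (fun X Y σ => by
      ext1 q
      refine dual_ext (E := E) (G := G) fun s => ?_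
      have h1 := D.dualFun_apply (X + Y) σ q s
      have h2 := D.dualFun_apply X σ q s
      have h3 := D.dualFun_apply Y σ q s
      have h4 : (pair (σ q) (D.toFun (X + Y) s q)) =
          (pair (σ q) (D.toFun X s q)) + (pair (σ q) (D.toFun Y s q)) := by
        rw [map_add]; exact (σ q).map_add _ _
      have h5 : dirDeriv (L.anchor q ((X + Y) q)) (pairing σ s) =
          dirDeriv (L.anchor q (X q)) (pairing σ s) + dirDeriv (L.anchor q (Y q)) (pairing σ s) := by
        rw [ContMDiffSection.coe_add, Pi.add_apply, map_add]; exact map_add _ _ _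
      refine h1.trans ?_
      rw [h4, h5]
      refine Eq.trans ?_ (congrArg₂ (· + ·) h2 h3).symm
      ring)
    (fun r X σ => by
      ext1 q
      refine dual_ext (E := E) (G := G) fun s => ?_
      have h1 := D.dualFun_apply (r • X) σ q s
      have h2 := D.dualFun_apply X σ q s
      have h4 : (pair (σ q) (D.toFun (r • X) s q)) = r * (pair (σ q) (D.toFun X s q)) := by
        rw [map_smul]; exact (σ q).map_smul _ _
      have h5 : dirDeriv (L.anchor q ((r • X) q)) (pairing σ s) =
          r * dirDeriv (L.anchor q (X q)) (pairing σ s) := by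
        rw [ContMDiffSection.coe_smul, Pi.smul_apply, map_smul]; exact map_smul _ _ _
      refine h1.trans ?_
      rw [h4, h5, ← mul_sub]
      exact congrArg (r * ·) h2.symm)
    (fun X σ τ => by
      ext1 q
      refine dual_ext (E := E) (G := G) fun s => ?_
      have h1 := D.dualFun_apply X (σ + τ) q s
      have h2 := D.dualFun_apply X σ q s
      have h3 := D.dualFun_apply X τ q s
      have h5 : dirDeriv (L.anchor q (X q)) (pairing (σ + τ) s) =
          dirDeriv (L.anchor q (X q)) (pairing σ s) + dirDeriv (L.anchor q (X q)) (pairing τ s) :=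
        dirDeriv_add _ (pairing σ s) (pairing τ s)
      have h4 : (pair ((σ + τ) q) (D.toFun X s q)) =
          (pair (σ q) (D.toFun X s q)) + (pair (τ q) (D.toFun X s q)) := rfl
      refine h1.trans ?_
      rw [h4, h5]
      refine Eq.trans ?_ (congrArg₂ (· + ·) h2 h3).symm
      ring)
    (fun r X σ => by
      ext1 q
      refine dual_ext (E := E) (G := G) fun s => ?_
      have h1 := D.dualFun_apply X (r • σ) q s
      have h2 := D.dualFun_apply X σ q s
      have h5 : dirDeriv (L.anchor q (X q)) (pairing (r • σ) s) =
          r * dirDeriv (L.anchor q (X q)) (pairing σ s) := by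
        have := dirDeriv_mul (L.anchor q (X q)) (ContMDiffMap.const r) (pairing σ s)
        rw [dirDeriv_const, mul_zero, add_zero] at this
        exact this
      have h4 : (pair ((r • σ) q) (D.toFun X s q)) =
          r * (pair (σ q) (D.toFun X s q)) := rfl
      refine h1.trans ?_
      rw [h4, h5, ← mul_sub]
      exact congrArg (r * ·) h2.symm)
  mul_left f X σ q := D.dualFun_mul_left f X σ q
  leibniz f X σ q := D.dualFun_leibniz f X σ q

end AConnection
end Algebroid

section Connection
variable {E : Type*} [NormedAddCommGroup E] [NormedSpace ℝ E] [FiniteDimensional ℝ E]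
  {Q : Type*} [TopologicalSpace Q] [ChartedSpace E Q] [IsManifold 𝓘(ℝ, E) ∞ Q] [T2Space Q]
  {F : Type*} [NormedAddCommGroup F] [NormedSpace ℝ F] [FiniteDimensional ℝ F]
  {A : Q → Type*} [TopologicalSpace (TotalSpace F A)]
  [∀ q, AddCommGroup (A q)] [∀ q, Module ℝ (A q)] [∀ q, TopologicalSpace (A q)]
  [∀ q, IsTopologicalAddGroup (A q)] [∀ q, ContinuousSMul ℝ (A q)]
  [FiberBundle F A] [VectorBundle ℝ F A] [ContMDiffVectorBundle ∞ F A 𝓘(ℝ, E)]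

theorem cov_add (N : CovariantDerivative 𝓘(ℝ, E) F A) (X Y : Sec E F A) (q : Q) :
    N (⇑(X + Y)) q = N X q + N Y q :=
  N.isCovariantDerivativeOnUniv.add X.mdifferentiableAt Y.mdifferentiableAt

theorem cov_mulSec (N : CovariantDerivative 𝓘(ℝ, E) F A) (f : Fn E Q) (X : Sec E F A) (q : Q)
    (v : TangentSpace 𝓘(ℝ, E) q) :
    N (⇑(mulSec f X)) q v = dirDeriv v f • X q + f q • N X q v := by
  have := N.isCovariantDerivativeOnUniv.leibniz X.mdifferentiableAt (fn_mdiff f q)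
  have h2 := congrArg (fun l => l v) this
  rw [add_comm]
  exact h2

theorem cov_smul (N : CovariantDerivative 𝓘(ℝ, E) F A) (r : ℝ) (X : Sec E F A) (q : Q) :
    N (⇑(r • X)) q = r • N X q :=
  N.isCovariantDerivativeOnUniv.smul_const r X.mdifferentiableAt

/-- The section `∇_v X` of `A`, for a vector field `v` on `Q` and a section `X` of `A`. -/
def covAlong (N : CovariantDerivative 𝓘(ℝ, E) F A) [CovariantDerivative.ContMDiffCovariantDerivative N ∞]
    (v : Cₛ^∞⟮𝓘(ℝ, E); E, (TangentSpace 𝓘(ℝ, E) : Q → Type _)⟯) (X : Sec E F A) : Sec E F A :=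
  ⟨fun q => N X q (v q), by
    have h : ContMDiff 𝓘(ℝ, E) (𝓘(ℝ, E).prod 𝓘(ℝ, E →L[ℝ] F)) ∞ (fun q : Q =>
        TotalSpace.mk' (E →L[ℝ] F) (E := fun q => TangentSpace 𝓘(ℝ, E) q →L[ℝ] A q) q (N X q)) :=
      contMDiffOn_univ.1 ((CovariantDerivative.ContMDiffCovariantDerivative.contMDiff (cov := N) (k := ∞)).contMDiff
        (σ := X) (contMDiffOn_univ.2 X.contMDiff))
    exact h.clm_bundle_apply v.contMDiff⟩

namespace LieAlgebroid
variable (L : LieAlgebroid E F A)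

/-- The vector field `ρ(Y)` on `Q`. -/
def anchorSec (Y : Sec E F A) : Cₛ^∞⟮𝓘(ℝ, E); E, (TangentSpace 𝓘(ℝ, E) : Q → Type _)⟯ :=
  ⟨fun q => L.anchor q (Y q), L.anchor.contMDiff.clm_bundle_apply Y.contMDiff⟩

theorem bracket_swap (X Y : Sec E F A) : L.bracket X Y = - L.bracket Y X := by
  have h := L.bracket_self (X + Y)
  simp only [map_add, LinearMap.add_apply, L.bracket_self, zero_add, add_zero] at h
  exact eq_neg_of_add_eq_zero_right h

/-- The `A`-connection `∇̄` on `A` induced by a `TQ`-connection `∇` on `A`: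
`∇̄_X Y = ∇_{ρ(Y)} X + [X, Y]`. -/
def bar (N : CovariantDerivative 𝓘(ℝ, E) F A) [CovariantDerivative.ContMDiffCovariantDerivative N ∞] :
    AConnection F A L where
  toFun := LinearMap.mk₂ ℝ (fun X Y => covAlong N (L.anchorSec Y) X + L.bracket X Y)
    (fun X X' Y => by
      ext q
      change N (⇑(X + X')) q (L.anchor q (Y q)) + L.bracket (X + X') Y q =
        (N X q (L.anchor q (Y q)) + L.bracket X Y q) + (N X' q (L.anchor q (Y q)) + L.bracket X' Y q)
      rw [cov_add, map_add]
      simp only [LinearMap.add_apply, ContMDiffSection.coe_add, Pi.add_apply,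
        _root_.add_apply]
      abel)
    (fun r X Y => by
      ext q
      change N (⇑(r • X)) q (L.anchor q (Y q)) + L.bracket (r • X) Y q =
        r • (N X q (L.anchor q (Y q)) + L.bracket X Y q)
      rw [cov_smul, map_smul, smul_add]
      rfl)
    (fun X Y Y' => by
      ext q
      simp [covAlong, anchorSec]; abel)
    (fun r X Y => by
      ext q
      simp [covAlong, anchorSec])
  mul_left f X Y q := by
    have h : L.bracket (mulSec f X) Y q =
       - (dirDeriv (L.anchor q (Y q)) f • X q + f q • L.bracket Y X q) := by
      rw [L.bracket_swap, ContMDiffSection.coe_neg, Pi.neg_apply, L.leibniz]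
    have h2 := cov_mulSec N f X q (L.anchor q (Y q))
    have h3 : L.bracket X Y q = - L.bracket Y X q := by rw [L.bracket_swap]; rfl
    change N (⇑(mulSec f X)) q (L.anchor q (Y q)) + L.bracket (mulSec f X) Y q =
      f q • (N X q (L.anchor q (Y q)) + L.bracket X Y q)
    rw [h, h2, h3]
    module
  leibniz f X Y q := by
    change N X q (L.anchor q (f q • Y q)) + L.bracket X (mulSec f Y) q =
      _ + f q • (N X q (L.anchor q (Y q)) + L.bracket X Y q)
    rw [L.leibniz, map_smul, map_smul]
    module
end LieAlgebroid

theorem exists_dualCov (N : CovariantDerivative 𝓘(ℝ, E) F A) (q : Q)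
    (σ : Sec E (F →L[ℝ] ℝ) (DualBundle A)) (v : TangentSpace 𝓘(ℝ, E) q) :
    ∃ φ : DualBundle A q, ∀ s : Sec E F A,
      pair φ (s q) = dirDeriv v (pairing σ s) - (pair (σ q) (N s q v)) :=
  exists_dual v (fun s => N s q v) (fun s t => by rw [cov_add]; rfl)
    (fun f s => cov_mulSec N f s q v) σ

/-- The value `∇*_v σ ∈ A*_q` of the dual of a `TQ`-connection `∇` on `A`, for `v ∈ T_q Q`,
characterized by `⟨∇*_v σ, s⟩ = v[⟨σ, s⟩] - ⟨σ, ∇_v s⟩` for all sections `s` of `A`. -/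
def dualCov (N : CovariantDerivative 𝓘(ℝ, E) F A) (q : Q)
    (σ : Sec E (F →L[ℝ] ℝ) (DualBundle A)) (v : TangentSpace 𝓘(ℝ, E) q) : DualBundle A q :=
  (exists_dualCov N q σ v).choose

theorem dualCov_apply (N : CovariantDerivative 𝓘(ℝ, E) F A) (q : Q)
    (σ : Sec E (F →L[ℝ] ℝ) (DualBundle A)) (v : TangentSpace 𝓘(ℝ, E) q) (s : Sec E F A) :
    (pair (dualCov N q σ v) (s q)) =
      dirDeriv v (pairing σ s) - (pair (σ q) (N s q v)) :=
  (exists_dualCov N q σ v).choose_spec s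

theorem dualCov_add (N : CovariantDerivative 𝓘(ℝ, E) F A) (q : Q)
    (σ : Sec E (F →L[ℝ] ℝ) (DualBundle A)) (v w : TangentSpace 𝓘(ℝ, E) q) :
    dualCov N q σ (v + w) = dualCov N q σ v + dualCov N q σ w := by
  refine dual_ext (E := E) (G := F) fun s => ?_
  have h1 := dualCov_apply N q σ (v + w) s
  have h2 := dualCov_apply N q σ v s
  have h3 := dualCov_apply N q σ w s
  have h4 : (pair (σ q) (N s q (v + w))) =
      (pair (σ q) (N s q v)) + (pair (σ q) (N s q w)) := by
    rw [map_add]; exact (σ q).map_add _ _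
  have h5 : dirDeriv (v + w) (pairing σ s) = dirDeriv v (pairing σ s) + dirDeriv w (pairing σ s) :=
    map_add _ _ _
  refine h1.trans ?_
  rw [h4, h5]
  refine Eq.trans ?_ (congrArg₂ (· + ·) h2 h3).symm
  ring

theorem dualCov_smul (N : CovariantDerivative 𝓘(ℝ, E) F A) (q : Q)
    (σ : Sec E (F →L[ℝ] ℝ) (DualBundle A)) (r : ℝ) (v : TangentSpace 𝓘(ℝ, E) q) :
    dualCov N q σ (r • v) = r • dualCov N q σ v := by
  refine dual_ext (E := E) (G := F) fun s => ?_
  have h1 := dualCov_apply N q σ (r • v) s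
  have h2 := dualCov_apply N q σ v s
  have h4 : (pair (σ q) (N s q (r • v))) = r * (pair (σ q) (N s q v)) := by
    rw [map_smul]; exact (σ q).map_smul _ _
  have h5 : dirDeriv (r • v) (pairing σ s) = r * dirDeriv v (pairing σ s) := map_smul _ _ _
  refine h1.trans ?_
  rw [h4, h5, ← mul_sub]
  exact congrArg (r * ·) h2.symm

/-- The total space of the dual bundle `A*`, a smooth manifold. -/
abbrev DualTot (F : Type*) [NormedAddCommGroup F] [NormedSpace ℝ F] {Q : Type*} (A : Q → Type*)
   [∀ q, AddCommGroup (A q)] [∀ q, Module ℝ (A q)] [∀ q, TopologicalSpace (A q)] : Type _ :=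
  TotalSpace (F →L[ℝ] ℝ) (DualBundle A)

/-- The model with corners of the manifold `A*`. -/
abbrev DualModel (E F : Type*) [NormedAddCommGroup E] [NormedSpace ℝ E] [NormedAddCommGroup F]
    [NormedSpace ℝ F] := 𝓘(ℝ, E).prod 𝓘(ℝ, F →L[ℝ] ℝ)

/-- The vertical lift `V_p r ∈ T_p A*` of `r ∈ A*_q`, `q = π(p)`: the velocity at `0` of the line
`τ ↦ p + τ r` in the fibre. -/
def vertLift (p : DualTot F A) (r : DualBundle A p.proj) : TangentSpace (DualModel E F) p :=
  show E × (F →L[ℝ] ℝ) from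
    mfderiv 𝓘(ℝ, ℝ) (DualModel E F) (fun ε : ℝ => (⟨p.proj, p.2 + ε • r⟩ : DualTot F A)) 0 (1 : ℝ)

theorem hasMFDerivAt_line (p : DualTot F A) (r : DualBundle A p.proj) :
    HasMFDerivAt 𝓘(ℝ, ℝ) (DualModel E F) (fun ε : ℝ => (⟨p.proj, p.2 + ε • r⟩ : DualTot F A)) 0
      (ContinuousLinearMap.smulRight (1 : ℝ →L[ℝ] ℝ)
        ((0, (trivializationAt (F →L[ℝ] ℝ) (DualBundle A) p.proj ⟨p.proj, r⟩).2) :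
          E × (F →L[ℝ] ℝ))) := by
  set e := trivializationAt (F →L[ℝ] ℝ) (DualBundle A) p.proj
  have hq : p.proj ∈ e.baseSet := FiberBundle.mem_baseSet_trivializationAt _ _ _
  have hlin : ∀ ε : ℝ, (e ⟨p.proj, p.2 + ε • r⟩).2 = (e p).2 + ε • (e ⟨p.proj, r⟩).2 := by
    intro ε
    have h := (e.linear ℝ hq)
    rw [h.map_add, h.map_smul]
  constructor
  · exact ((FiberBundle.totalSpaceMk_isInducing (F →L[ℝ] ℝ) (DualBundle A) p.proj).continuous.comp
      (by fun_prop)).continuousAt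
  · have hext : ∀ ε : ℝ, extChartAt (DualModel E F) (⟨p.proj, p.2 + (0 : ℝ) • r⟩ : DualTot F A)
        ⟨p.proj, p.2 + ε • r⟩ = (extChartAt 𝓘(ℝ, E) p.proj p.proj, (e p).2 + ε • (e ⟨p.proj, r⟩).2) := by
      intro ε
      rw [FiberBundle.extChartAt, ← hlin]
      refine Prod.ext ?_ rfl
      exact congrArg (extChartAt 𝓘(ℝ, E) p.proj) (e.coe_fst' (x := ⟨p.proj, p.2 + ε • r⟩) hq)
    have hw : writtenInExtChartAt 𝓘(ℝ, ℝ) (DualModel E F) (0 : ℝ)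
        (fun ε : ℝ => (⟨p.proj, p.2 + ε • r⟩ : DualTot F A)) =
        fun ε => (extChartAt 𝓘(ℝ, E) p.proj p.proj, (e p).2 + ε • (e ⟨p.proj, r⟩).2) := by
      funext ε
      exact hext ε
    rw [hw]
    refine HasFDerivAt.hasFDerivWithinAt ?_
    have := ((hasFDerivAt_id (𝕜 := ℝ) (0 : ℝ)).smul_const (e ⟨p.proj, r⟩).2).const_add (e p).2
    refine ((hasFDerivAt_const (extChartAt 𝓘(ℝ, E) p.proj p.proj) (0 : ℝ)).prodMk this).congr_fderiv ?_
    refine ContinuousLinearMap.ext_ring (Prod.ext ?_ ?_)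
    · exact (smul_zero (1 : ℝ)).symm
    · rfl

theorem vertLift_eq (p : DualTot F A) (r : DualBundle A p.proj) :
    vertLift (E := E) p r =
      (show E × (F →L[ℝ] ℝ) from
        (0, (trivializationAt (F →L[ℝ] ℝ) (DualBundle A) p.proj ⟨p.proj, r⟩).2)) := by
  rw [vertLift, (hasMFDerivAt_line (E := E) p r).mfderiv]
  exact one_smul ℝ ((0, _) : E × (F →L[ℝ] ℝ))

theorem vertLift_add (p : DualTot F A) (r r' : DualBundle A p.proj) :
    vertLift (E := E) p (r + r') = vertLift p r + vertLift p r' := by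
  have h := (trivializationAt (F →L[ℝ] ℝ) (DualBundle A) p.proj).linear ℝ
    (FiberBundle.mem_baseSet_trivializationAt (F →L[ℝ] ℝ) (DualBundle A) p.proj)
  rw [vertLift_eq, vertLift_eq, vertLift_eq, h.map_add]
  refine Prod.ext ?_ rfl
  exact (add_zero (0 : E)).symm

theorem vertLift_smul (p : DualTot F A) (c : ℝ) (r : DualBundle A p.proj) :
    vertLift (E := E) p (c • r) = c • vertLift p r := by
  have h := (trivializationAt (F →L[ℝ] ℝ) (DualBundle A) p.proj).linear ℝ
    (FiberBundle.mem_baseSet_trivializationAt (F →L[ℝ] ℝ) (DualBundle A) p.proj)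
  rw [vertLift_eq, vertLift_eq, h.map_smul]
  refine Prod.ext ?_ rfl
  exact (smul_zero c).symm

theorem trivialization_dual_apply (q : Q) (p : DualTot F A)
    (hp : p.proj ∈ (trivializationAt F A q).baseSet) (g : F) :
    (trivializationAt (F →L[ℝ] ℝ) (DualBundle A) q p).2 g =
      p.2 ((trivializationAt F A q).symm p.proj g) := by
  rw [← (trivializationAt F A q).symmL_apply (R := ℝ) hp, hom_trivializationAt_apply]
  simp [ContinuousLinearMap.inCoordinates]

theorem exists_eval {W : Type*} [NormedAddCommGroup W] [NormedSpace ℝ W] [FiniteDimensional ℝ W]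
    (T : (W →L[ℝ] ℝ) →ₗ[ℝ] ℝ) : ∃ w : W, ∀ φ : W →L[ℝ] ℝ, φ w = T φ := by
  let b := Module.finBasis ℝ W
  refine ⟨∑ i, T (LinearMap.toContinuousLinearMap (b.coord i)) • b i, fun φ => ?_⟩
  have h : φ = ∑ i, φ (b i) • LinearMap.toContinuousLinearMap (b.coord i) := by
    apply ContinuousLinearMap.coe_injective
    refine b.ext fun j => ?_
    simp [Finsupp.single_apply]
  conv_rhs => rw [h]
  simp [mul_comm]

theorem exists_ver (p : DualTot F A) (α : TangentSpace (DualModel E F) p →L[ℝ] ℝ) :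
    ∃ a : A p.proj, ∀ r : DualBundle A p.proj, pair r a = α (vertLift p r) := by
  obtain ⟨g, hg⟩ := exists_eval (W := F)
    ((show E × (F →L[ℝ] ℝ) →L[ℝ] ℝ from α).toLinearMap ∘ₗ LinearMap.inr ℝ E (F →L[ℝ] ℝ))
  refine ⟨(trivializationAt F A p.proj).symm p.proj g, fun r => ?_⟩
  rw [vertLift_eq]
  refine (trivialization_dual_apply p.proj ⟨p.proj, r⟩
    (FiberBundle.mem_baseSet_trivializationAt F A p.proj) g).symm.trans ?_
  exact hg _

/-- The vertical part `α^ver ∈ A_q` of a covector `α ∈ T*_p A*`: the unique element with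
`⟨r, α^ver⟩ = ⟨α, V_p r⟩` for all `r ∈ A*_q`. -/
def ver (p : DualTot F A) (α : TangentSpace (DualModel E F) p →L[ℝ] ℝ) : A p.proj :=
  (exists_ver p α).choose

theorem apply_ver (p : DualTot F A) (α : TangentSpace (DualModel E F) p →L[ℝ] ℝ)
    (r : DualBundle A p.proj) : pair r (ver p α) = α (vertLift p r) :=
  (exists_ver p α).choose_spec r

theorem exists_dualSec_through (p : DualTot F A) :
    ∃ μ : Sec E (F →L[ℝ] ℝ) (DualBundle A), μ p.proj = p.2 :=
  exists_section_through E (F →L[ℝ] ℝ) p.proj p.2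

/-- A section `μ` of `A*` with `μ(q) = p`, where `q = π(p)`. -/
def secThrough (p : DualTot F A) : Sec E (F →L[ℝ] ℝ) (DualBundle A) :=
  (exists_dualSec_through p).choose

theorem secThrough_apply (p : DualTot F A) : secThrough (E := E) p p.proj = p.2 :=
  (exists_dualSec_through p).choose_spec

/-- The tangent map `T_q μ : T_q Q → T_p A*` of a section `μ` of `A*` with `μ(q) = p`. -/
def tangentAt (μ : Sec E (F →L[ℝ] ℝ) (DualBundle A)) (p : DualTot F A) :
    TangentSpace 𝓘(ℝ, E) p.proj →L[ℝ] TangentSpace (DualModel E F) p :=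
  show E →L[ℝ] (E × (F →L[ℝ] ℝ)) from
    mfderiv 𝓘(ℝ, E) (DualModel E F) (fun q => (⟨q, μ q⟩ : DualTot F A)) p.proj

/-- The horizontal lift `H_p v = Tμ(v) - V_p(∇*_v μ) ∈ T_p A*` of `v ∈ T_q Q`, where `μ` is a section
of `A*` with `μ(q) = p`; the result does not depend on `μ`. -/
def horLift (N : CovariantDerivative 𝓘(ℝ, E) F A) (p : DualTot F A)
    (v : TangentSpace 𝓘(ℝ, E) p.proj) : TangentSpace (DualModel E F) p :=
  tangentAt (secThrough p) p v - vertLift p (dualCov N p.proj (secThrough p) v)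

theorem horLift_add (N : CovariantDerivative 𝓘(ℝ, E) F A) (p : DualTot F A)
    (v w : TangentSpace 𝓘(ℝ, E) p.proj) :
    horLift N p (v + w) = horLift N p v + horLift N p w := by
  simp only [horLift]
  rw [dualCov_add, vertLift_add, (tangentAt (secThrough p) p).map_add]
  abel

theorem horLift_smul (N : CovariantDerivative 𝓘(ℝ, E) F A) (p : DualTot F A) (r : ℝ)
    (v : TangentSpace 𝓘(ℝ, E) p.proj) :
    horLift N p (r • v) = r • horLift N p v := by
  simp only [horLift]
  rw [dualCov_smul, vertLift_smul, (tangentAt (secThrough p) p).map_smul, smul_sub]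

/-- The horizontal part `α^hor ∈ T*_q Q` of a covector `α ∈ T*_p A*`:
`⟨α^hor, v⟩ = ⟨α, H_p v⟩` for all `v ∈ T_q Q`. -/
def hor (N : CovariantDerivative 𝓘(ℝ, E) F A) (p : DualTot F A)
    (α : TangentSpace (DualModel E F) p →L[ℝ] ℝ) : TangentSpace 𝓘(ℝ, E) p.proj →L[ℝ] ℝ where
  toFun v := α (horLift N p v)
  map_add' v w := by rw [horLift_add, α.map_add]
  map_smul' r v := by rw [horLift_smul, α.map_smul, RingHom.id_apply]
  cont := LinearMap.continuous_of_finiteDimensional (E := E) (F' := ℝ)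
    { toFun := fun v => α (horLift N p v)
      map_add' := fun v w => (congrArg α (horLift_add N p v w)).trans (map_add α _ _)
      map_smul' := fun r v => (congrArg α (horLift_smul N p r v)).trans (map_smul α _ _) }

/-! ### The Lie–Poisson tensor -/

/-- The covector `d(Φ_X + f ∘ π)(p)` at `p`, where `Φ_X(p) = ⟨p, X⟩`. -/
def dPhi (p : DualTot F A) (X : Sec E F A) (f : Fn E Q) :
    TangentSpace (DualModel E F) p →L[ℝ] ℝ :=
  mvfderiv (DualModel E F) (fun p' : DualTot F A => (pair p'.2 (X p'.proj)) + f p'.proj) p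

/-- Every covector at `p` has the form `d(Φ_X + f ∘ π)(p)`. -/
theorem exists_dPhi_eq (p : DualTot F A) (α : TangentSpace (DualModel E F) p →L[ℝ] ℝ) :
    ∃ (X : Sec E F A) (f : Fn E Q), dPhi p X f = α := by
  set e := trivializationAt F A p.proj
  set e' := trivializationAt (F →L[ℝ] ℝ) (DualBundle A) p.proj
  let α' : E × (F →L[ℝ] ℝ) →L[ℝ] ℝ := α
  obtain ⟨g, hg⟩ := exists_eval (W := F) (α'.toLinearMap ∘ₗ LinearMap.inr ℝ E (F →L[ℝ] ℝ))
  obtain ⟨X, hX⟩ := exists_section_const E (V := A) p.proj g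
  obtain ⟨ψ⟩ : Nonempty (SmoothBumpFunction 𝓘(ℝ, E) p.proj) := inferInstance
  let f : Fn E Q := ⟨fun x => ψ x • α' (extChartAt 𝓘(ℝ, E) p.proj x, 0), by
    refine ψ.contMDiff_smul ?_
    exact (α' ∘L ContinuousLinearMap.inl ℝ E (F →L[ℝ] ℝ)).contMDiff.comp_contMDiffOn
      (contMDiffOn_extChartAt (n := ∞))⟩
  refine ⟨X, f, ?_⟩
  have key : (fun p' : DualTot F A => (pair p'.2 (X p'.proj)) + f p'.proj) =ᶠ[𝓝 p]
      fun p' => α' (extChartAt (DualModel E F) p p') := by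
    have hc : Filter.Tendsto (fun p' : DualTot F A => p'.proj) (𝓝 p) (𝓝 p.proj) :=
      (FiberBundle.continuous_proj (F →L[ℝ] ℝ) (DualBundle A)).tendsto p
    filter_upwards [hc.eventually hX, hc.eventually ψ.eventuallyEq_one, hc.eventually
      (e.open_baseSet.mem_nhds (FiberBundle.mem_baseSet_trivializationAt F A p.proj)), hc.eventually
      (e'.open_baseSet.mem_nhds
        (FiberBundle.mem_baseSet_trivializationAt (F →L[ℝ] ℝ) (DualBundle A) p.proj))]
      with p' h1 h2 h3 h3'
    have hsum : ∀ (x : E) (φ : F →L[ℝ] ℝ), α' (x, φ) = φ g + α' (x, 0) := fun x φ => by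
      rw [hg, ← sub_eq_iff_eq_add]
      refine (map_sub α' _ _).symm.trans (congrArg α' ?_)
      exact Prod.ext (sub_self x) (sub_zero φ)
    have hext : extChartAt (DualModel E F) p p' = (extChartAt 𝓘(ℝ, E) p.proj p'.proj, (e' p').2) := by
      rw [FiberBundle.extChartAt]
      refine Prod.ext ?_ rfl
      exact congrArg (extChartAt 𝓘(ℝ, E) p.proj) (e'.coe_fst' (x := p') h3')
    have h4 : f p'.proj = α' (extChartAt 𝓘(ℝ, E) p.proj p'.proj, 0) := by
      change ψ p'.proj • α' (extChartAt 𝓘(ℝ, E) p.proj p'.proj, 0) = _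
      rw [h2, Pi.one_apply, one_smul]
    rw [hext, hsum, trivialization_dual_apply p.proj p' h3 g, h4, h1]
  have h2 : HasMFDerivAt (DualModel E F) 𝓘(ℝ) (fun p' => α' (extChartAt (DualModel E F) p p')) p α := by
    constructor
    · exact α'.continuous.continuousAt.comp (continuousAt_extChartAt p)
    · have : HasFDerivWithinAt (fun x => α' x) α' (range (DualModel E F))
        (extChartAt (DualModel E F) p p) := α'.hasFDerivAt.hasFDerivWithinAt
      refine this.congr_of_eventuallyEq ?_ ?_
      · filter_upwards [extChartAt_target_mem_nhdsWithin (I := DualModel E F) p] with x hx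
        exact congrArg α' ((extChartAt (DualModel E F) p).right_inv hx)
      · exact congrArg (fun z => α' (extChartAt (DualModel E F) p z))
          (extChartAt_to_inv (I := DualModel E F) p)
  have h3 := h2.congr_of_eventuallyEq key
  have h4 : mfderiv (DualModel E F) 𝓘(ℝ)
    (fun p' : DualTot F A => (pair p'.2 (X p'.proj)) + f p'.proj) p = α := h3.mfderiv
  unfold dPhi mvfderiv
  rw [h4]
  rfl

theorem contMDiff_Phi_add (X : Sec E F A) (f : Fn E Q) : ContMDiff (DualModel E F) 𝓘(ℝ) ∞
    (fun p' : DualTot F A => (pair p'.2 (X p'.proj)) + f p'.proj) := by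
  have hπ : ContMDiff (DualModel E F) 𝓘(ℝ, E) ∞ (fun p' : DualTot F A => p'.proj) :=
    contMDiff_proj (DualBundle A)
  have h1 : ContMDiff (DualModel E F) (𝓘(ℝ, E).prod 𝓘(ℝ, F →L[ℝ] ℝ)) ∞ (fun p' : DualTot F A =>
      TotalSpace.mk' (F →L[ℝ] ℝ) (E := DualBundle A) p'.proj p'.2) := contMDiff_id
  have h2 : ContMDiff (DualModel E F) (𝓘(ℝ, E).prod 𝓘(ℝ, F)) ∞ (fun p' : DualTot F A =>
      TotalSpace.mk' F (E := A) p'.proj (X p'.proj)) := X.contMDiff.comp hπ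
  have h3 := h1.clm_bundle_apply (F₂ := ℝ) (E₂ := Bundle.Trivial Q ℝ) h2
  refine ContMDiff.add (fun p => ?_) (f.contMDiff.comp hπ)
  exact (contMDiffAt_totalSpace.1 (h3 p)).2

theorem dPhi_vertLift (p : DualTot F A) (X : Sec E F A) (f : Fn E Q) (r : DualBundle A p.proj) :
    dPhi p X f (vertLift p r) = pair r (X p.proj) := by
  have hΦ : MDifferentiableAt (DualModel E F) 𝓘(ℝ)
      (fun p' : DualTot F A => (pair p'.2 (X p'.proj)) + f p'.proj)
      ((fun ε : ℝ => (⟨p.proj, p.2 + ε • r⟩ : DualTot F A)) 0) :=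
    (contMDiff_Phi_add X f).mdifferentiable (by simp) _
  have hc := hΦ.hasMFDerivAt.comp (0 : ℝ) (hasMFDerivAt_line (E := E) p r)
  have hd : HasDerivAt (fun ε : ℝ => (pair p.2 (X p.proj)) +
      ε * (pair r (X p.proj)) + f p.proj) (pair r (X p.proj)) 0 := by
    have := (((hasDerivAt_id (0 : ℝ)).mul_const (pair r (X p.proj))).const_add
      (pair p.2 (X p.proj))).add_const (f p.proj)
    rw [one_mul] at this
    exact this
  have h1 := hasMFDerivAt_unique hc hd.hasFDerivAt.hasMFDerivAt
  have h2 := congrArg (fun l : ℝ →L[ℝ] ℝ => l 1) h1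
  have h0 : (⟨p.proj, p.2 + (0 : ℝ) • r⟩ : DualTot F A) = p := by
    rw [zero_smul, add_zero]
  have h3 : ∀ p₁ p₂ : DualTot F A, p₁ = p₂ →
      (show (E × (F →L[ℝ] ℝ)) →L[ℝ] ℝ from mfderiv (DualModel E F) 𝓘(ℝ)
        (fun p' : DualTot F A => (pair p'.2 (X p'.proj)) + f p'.proj) p₁) =
      (show (E × (F →L[ℝ] ℝ)) →L[ℝ] ℝ from mfderiv (DualModel E F) 𝓘(ℝ)
        (fun p' : DualTot F A => (pair p'.2 (X p'.proj)) + f p'.proj) p₂) := by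
    rintro p₁ _ rfl; rfl
  rw [vertLift_eq]
  have h4 := congrArg (fun l : (E × (F →L[ℝ] ℝ)) →L[ℝ] ℝ => l ((1 : ℝ) •
    ((0, (trivializationAt (F →L[ℝ] ℝ) (DualBundle A) p.proj ⟨p.proj, r⟩).2) :
          E × (F →L[ℝ] ℝ)))) (h3 _ _ h0)
  refine Eq.trans ?_ (h4.symm.trans (h2.trans (one_smul ℝ (pair r (X p.proj)))))
  simp only [one_smul]
  rfl

theorem dPhi_tangentAt (p : DualTot F A) (X : Sec E F A) (f : Fn E Q)
    (μ : Sec E (F →L[ℝ] ℝ) (DualBundle A)) (hμ : μ p.proj = p.2) (v : TangentSpace 𝓘(ℝ, E) p.proj) :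
    dPhi p X f (tangentAt μ p v) = dirDeriv v (pairing μ X) + dirDeriv v f := by
  obtain ⟨q, p⟩ := p
  obtain rfl : μ q = p := hμ
  have hΦ : MDifferentiableAt (DualModel E F) 𝓘(ℝ)
      (fun p' : DualTot F A => (pair p'.2 (X p'.proj)) + f p'.proj) (⟨q, μ q⟩ : DualTot F A) :=
    (contMDiff_Phi_add X f).mdifferentiable (by simp) _
  have hμ : MDifferentiableAt 𝓘(ℝ, E) (DualModel E F) (fun q => (⟨q, μ q⟩ : DualTot F A)) q :=
    μ.mdifferentiableAt
  have h1 := hΦ.hasMFDerivAt.comp q hμ.hasMFDerivAt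
  have h2 := (fn_mdiff (pairing μ X + f) q).hasMFDerivAt
  have h3 := hasMFDerivAt_unique h1 h2
  rw [← dirDeriv_add]
  exact congrArg (fun l : E →L[ℝ] ℝ => l v) h3

theorem eq_of_forall_dual (F : Type*) [NormedAddCommGroup F] [NormedSpace ℝ F]
    [FiniteDimensional ℝ F] {Q : Type*} [TopologicalSpace Q] {A : Q → Type*}
    [TopologicalSpace (TotalSpace F A)] [∀ q, AddCommGroup (A q)] [∀ q, Module ℝ (A q)]
    [∀ q, TopologicalSpace (A q)] [FiberBundle F A] [VectorBundle ℝ F A]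
    [∀ q, IsTopologicalAddGroup (A q)] [∀ q, ContinuousSMul ℝ (A q)] {q : Q} {a b : A q}
  (h : ∀ r : DualBundle A q, pair r a = pair r b) : a = b := by
  have : T2Space (A q) := FiberBundle.t2Space F A q
  have : FiniteDimensional ℝ (A q) := VectorBundle.finiteDimensional ℝ F A q
  rw [← sub_eq_zero, ← Module.forall_dual_apply_eq_zero_iff ℝ]
  intro φ
  have := h (LinearMap.toContinuousLinearMap φ)
  rw [map_sub, sub_eq_zero]
  exact this

theorem ver_dPhi (p : DualTot F A) (X : Sec E F A) (f : Fn E Q) :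
    ver p (dPhi p X f) = X p.proj :=
  eq_of_forall_dual F fun r => (apply_ver p _ r).trans (dPhi_vertLift p X f r)

/-- A section `X` of `A` such that `α = d(Φ_X + f ∘ π)(p)` for `f = repFn p α`. -/
def repSec (p : DualTot F A) (α : TangentSpace (DualModel E F) p →L[ℝ] ℝ) : Sec E F A :=
  (exists_dPhi_eq p α).choose

/-- A function `f` on `Q` such that `α = d(Φ_X + f ∘ π)(p)` for `X = repSec p α`. -/
def repFn (p : DualTot F A) (α : TangentSpace (DualModel E F) p →L[ℝ] ℝ) : Fn E Q :=
  (exists_dPhi_eq p α).choose_spec.choose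

theorem dPhi_rep (p : DualTot F A) (α : TangentSpace (DualModel E F) p →L[ℝ] ℝ) :
    dPhi p (repSec p α) (repFn p α) = α :=
  (exists_dPhi_eq p α).choose_spec.choose_spec

namespace LieAlgebroid
variable (L : LieAlgebroid E F A)

/-- The value at `p` of the bracket `{Φ_X + f ∘ π, Φ_Y + g ∘ π}` for the sign `+`, as dictated by
`{Φ_X, Φ_Y} = Φ_[X,Y]`, `{Φ_X, g ∘ π} = ρ(X)[g] ∘ π` and `{f ∘ π, g ∘ π} = 0`. -/
def bracketForm (p : DualTot F A) (X : Sec E F A) (f : Fn E Q) (Y : Sec E F A) (g : Fn E Q) : ℝ :=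
  (pair p.2 (L.bracket X Y p.proj)) + dirDeriv (L.anchor p.proj (X p.proj)) g -
    dirDeriv (L.anchor p.proj (Y p.proj)) f

/-- The Lie–Poisson tensor `Π` on `A*`, with sign `ε = ±1`: the bilinear form on `T*_p A*` with
`Π(d(Φ_X + f ∘ π), d(Φ_Y + g ∘ π)) = ε (⟨p, [X, Y]⟩ + ρ(X)[g] - ρ(Y)[f])`. Every covector is of the
form `d(Φ_X + f ∘ π)(p)`, and `poissonTensor_dPhi` shows that the value does not depend on the
chosen representatives. -/
def poissonTensor (ε : ℝ) (p : DualTot F A) (α β : TangentSpace (DualModel E F) p →L[ℝ] ℝ) : ℝ :=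
  ε * L.bracketForm p (repSec p α) (repFn p α) (repSec p β) (repFn p β)

theorem exists_hamVec (p : DualTot F A) (Y : Sec E F A) (g : Fn E Q) :
    ∃ v : TangentSpace (DualModel E F) p, ∀ (X : Sec E F A) (f : Fn E Q),
      dPhi p X f v = L.bracketForm p X f Y g := by
  obtain ⟨φ, hφ⟩ := exists_dual (L.anchor p.proj (Y p.proj)) (fun Z => L.bracket Y Z p.proj)
    (fun s t => by rw [map_add]; rfl) (fun f Z => L.leibniz f Y Z p.proj) (secThrough p)
  let dg : TangentSpace 𝓘(ℝ, E) p.proj →L[ℝ] ℝ := mvfderiv 𝓘(ℝ, E) g p.proj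
  let ψ : DualBundle A p.proj := dg ∘L L.anchor p.proj
  refine ⟨vertLift p (φ + ψ) - tangentAt (secThrough p) p (L.anchor p.proj (Y p.proj)), fun X f => ?_⟩
  rw [ContinuousLinearMap.map_sub, dPhi_vertLift, dPhi_tangentAt _ _ _ _ (secThrough_apply p)]
  have h1 : (pair (φ + ψ) (X p.proj)) = (pair φ (X p.proj)) +
    dirDeriv (L.anchor p.proj (X p.proj)) g := rfl
  have h2 := hφ X
  have h3 : (pair (secThrough (E := E) p p.proj) (L.bracket Y X p.proj)) =
      - (pair p.2 (L.bracket X Y p.proj)) := by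
    rw [secThrough_apply, L.bracket_swap]
    exact p.2.map_neg _
  refine (congrArg (· - (_ : ℝ)) (h1.trans (congrArg (· + (_ : ℝ)) h2))).trans ?_
  simp only [bracketForm]
  rw [h3]
  ring

theorem bracketForm_swap (p : DualTot F A) (X : Sec E F A) (f : Fn E Q) (Y : Sec E F A)
    (g : Fn E Q) : L.bracketForm p X f Y g = - L.bracketForm p Y g X f := by
  have : (pair p.2 (L.bracket X Y p.proj)) = -(pair p.2 (L.bracket Y X p.proj)) := by
    rw [L.bracket_swap]
    exact p.2.map_neg _
  simp only [bracketForm]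
  rw [this]
  ring

/-- The defining property of the Lie–Poisson tensor, for all representatives. -/
theorem poissonTensor_dPhi (ε : ℝ) (p : DualTot F A) (X : Sec E F A) (f : Fn E Q) (Y : Sec E F A)
    (g : Fn E Q) : L.poissonTensor ε p (dPhi p X f) (dPhi p Y g) = ε * L.bracketForm p X f Y g := by
  have key : ∀ (X X' : Sec E F A) (f f' : Fn E Q) (Y : Sec E F A) (g : Fn E Q),
      dPhi p X f = dPhi p X' f' → L.bracketForm p X f Y g = L.bracketForm p X' f' Y g := by
    intro X X' f f' Y g h
    obtain ⟨v, hv⟩ := L.exists_hamVec p Y g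
    rw [← hv, ← hv, h]
  rw [poissonTensor, key _ X _ f _ _ (dPhi_rep p _), bracketForm_swap,
    key _ Y _ g _ _ (dPhi_rep p _), ← bracketForm_swap]

theorem exists_hamiltonianVec (ε : ℝ) (p : DualTot F A)
    (β : TangentSpace (DualModel E F) p →L[ℝ] ℝ) :
    ∃ v : TangentSpace (DualModel E F) p, ∀ α : TangentSpace (DualModel E F) p →L[ℝ] ℝ,
      α v = L.poissonTensor ε p α β := by
  obtain ⟨v, hv⟩ := L.exists_hamVec p (repSec p β) (repFn p β)
  refine ⟨ε • v, fun α => ?_⟩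
  rw [α.map_smul, smul_eq_mul, poissonTensor, ← hv, dPhi_rep]

end LieAlgebroid

/-! ### The Lie–Poisson bracket and Hamiltonian vector fields -/

/-- The fibrewise-linear function `Φ_X(p) = ⟨p, X⟩` on `A*`. -/
def Phi (X : Sec E F A) : C^∞⟮DualModel E F, DualTot F A; ℝ⟯ :=
  ⟨fun p => pair p.2 (X p.proj), by
    have h := contMDiff_Phi_add X (0 : Fn E Q)
    have h0 : (fun p' : DualTot F A => (pair p'.2 (X p'.proj)) + (0 : Fn E Q) p'.proj) =
        fun p' => pair p'.2 (X p'.proj) := funext fun p' => add_zero _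
    exact h0 ▸ h⟩

/-- The pullback `f ∘ π` to `A*` of a function on `Q`. -/
def pullback (f : Fn E Q) : C^∞⟮DualModel E F, DualTot F A; ℝ⟯ :=
  ⟨fun p => f p.proj, f.contMDiff.comp (contMDiff_proj (DualBundle A))⟩

/-- The differential `dH(p) ∈ T*_p A*` of a function on `A*`. -/
def dH (H : C^∞⟮DualModel E F, DualTot F A; ℝ⟯) (p : DualTot F A) :
    TangentSpace (DualModel E F) p →L[ℝ] ℝ :=
  mvfderiv (DualModel E F) H p

theorem dH_Phi (p : DualTot F A) (X : Sec E F A) : dH (Phi X) p = dPhi p X 0 := by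
  have h0 : (fun p' : DualTot F A => (pair p'.2 (X p'.proj)) + (0 : Fn E Q) p'.proj) =
        fun p' => pair p'.2 (X p'.proj) := funext fun p' => add_zero _
  unfold dPhi dH
  rw [h0]
  rfl

theorem dH_pullback (p : DualTot F A) (f : Fn E Q) : dH (pullback (A := A) f) p = dPhi p 0 f := by
  have h0 : (fun p' : DualTot F A => (pair p'.2 ((0 : Sec E F A) p'.proj)) + f p'.proj) =
        fun p' => f p'.proj := funext fun p' =>
    (congrArg (· + f p'.proj) (map_zero p'.2)).trans (zero_add _)
  unfold dPhi dH
  rw [h0]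
  rfl

namespace LieAlgebroid
variable (L : LieAlgebroid E F A)

/-- The Lie–Poisson bracket `{G, H}(p) = Π(dG(p), dH(p))` on `A*`, with sign `ε = ±1`. -/
def poissonBracket (ε : ℝ) (G H : C^∞⟮DualModel E F, DualTot F A; ℝ⟯) (p : DualTot F A) : ℝ :=
  L.poissonTensor ε p (dH G p) (dH H p)

theorem poissonBracket_Phi_Phi (ε : ℝ) (X Y : Sec E F A) (p : DualTot F A) :
    L.poissonBracket ε (Phi X) (Phi Y) p = ε * Phi (L.bracket X Y) p := by
  rw [poissonBracket, dH_Phi, dH_Phi, poissonTensor_dPhi, bracketForm]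
  have h : ∀ v : TangentSpace 𝓘(ℝ, E) p.proj, dirDeriv v (0 : Fn E Q) = 0 := fun v =>
    dirDeriv_const v 0
  rw [h, h, add_zero, sub_zero]
  rfl

theorem poissonBracket_Phi_pullback (ε : ℝ) (X : Sec E F A) (g : Fn E Q) (p : DualTot F A) :
    L.poissonBracket ε (Phi X) (pullback g) p = ε * dirDeriv (L.anchor p.proj (X p.proj)) g := by
  rw [poissonBracket, dH_Phi, dH_pullback, poissonTensor_dPhi, bracketForm]
  have h : ∀ v : TangentSpace 𝓘(ℝ, E) p.proj, dirDeriv v (0 : Fn E Q) = 0 := fun v =>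
    dirDeriv_const v 0
  rw [h, sub_zero, map_zero]
  congr 1
  exact (congrArg (· + _) (map_zero p.2)).trans (zero_add _)

theorem poissonBracket_pullback_pullback (ε : ℝ) (f g : Fn E Q) (p : DualTot F A) :
    L.poissonBracket ε (pullback f) (pullback g) p = 0 := by
  rw [poissonBracket, dH_pullback, dH_pullback, poissonTensor_dPhi, bracketForm, map_zero]
  have h : ∀ f : Fn E Q, dirDeriv (L.anchor p.proj ((0 : Sec E F A) p.proj)) f = 0 := fun f =>
    (congrArg (fun v => dirDeriv v f) (map_zero (L.anchor p.proj))).trans (map_zero (mvfderiv 𝓘(ℝ, E) f p.proj))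
  rw [h, h, add_zero, sub_zero]
  exact (congrArg (ε * ·) (map_zero p.2)).trans (mul_zero ε)

/-- The Hamiltonian vector field `X_H` on `A*` for the Lie–Poisson structure with sign `ε`:
the vector field with `⟨α, X_H(p)⟩ = Π(α, dH(p))` for every covector `α` at `p`, that is,
`X_H[G] = {G, H}` for every function `G` on `A*`. -/
def hamiltonianVF (ε : ℝ) (H : C^∞⟮DualModel E F, DualTot F A; ℝ⟯) (p : DualTot F A) :
    TangentSpace (DualModel E F) p :=
  (L.exists_hamiltonianVec ε p (dH H p)).choose

theorem apply_hamiltonianVF (ε : ℝ) (H : C^∞⟮DualModel E F, DualTot F A; ℝ⟯) (p : DualTot F A)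
    (α : TangentSpace (DualModel E F) p →L[ℝ] ℝ) :
    α (L.hamiltonianVF ε H p) = L.poissonTensor ε p α (dH H p) :=
  (L.exists_hamiltonianVec ε p (dH H p)).choose_spec α

/-- The curve `a : t ↦ a(t) ∈ A_{q(t)}` is an `A`-path on `J` over the base path `q`:
`q̇ = ρ(a)` on `J` (one-sided derivatives at endpoints belonging to `J`). -/
def IsAPath (J : Set ℝ) (q : ℝ → Q) (a : ∀ t, A (q t)) : Prop :=
  ∀ t ∈ J, HasMFDerivWithinAt 𝓘(ℝ, ℝ) 𝓘(ℝ, E) q J t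
    (ContinuousLinearMap.smulRight (1 : ℝ →L[ℝ] ℝ) (L.anchor (q t) (a t)))

/-- The adjoint `ρ* : T*_q Q → A*_q` of the anchor. -/
def anchorDual (q : Q) (β : TangentSpace 𝓘(ℝ, E) q →L[ℝ] ℝ) : DualBundle A q :=
  β ∘L L.anchor q

end LieAlgebroid
end Connection

section Along
variable {E : Type*} [NormedAddCommGroup E] [NormedSpace ℝ E]
  {Q : Type*} [TopologicalSpace Q] [ChartedSpace E Q] [IsManifold 𝓘(ℝ, E) ∞ Q]
  {F : Type*} [NormedAddCommGroup F] [NormedSpace ℝ F]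
  {A : Q → Type*} [TopologicalSpace (TotalSpace F A)]
  [∀ q, AddCommGroup (A q)] [∀ q, Module ℝ (A q)] [∀ q, TopologicalSpace (A q)]
  [FiberBundle F A] [VectorBundle ℝ F A] [ContMDiffVectorBundle ∞ F A 𝓘(ℝ, E)]
  {G : Type*} [NormedAddCommGroup G] [NormedSpace ℝ G]
  {V : Q → Type*} [TopologicalSpace (TotalSpace G V)]
  [∀ q, AddCommGroup (V q)] [∀ q, Module ℝ (V q)] [∀ q, TopologicalSpace (V q)]
  [∀ q, ContinuousSMul ℝ (V q)]
  [FiberBundle G V] [VectorBundle ℝ G V] [ContMDiffVectorBundle ∞ G V 𝓘(ℝ, E)]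

/-- `w` is the covariant derivative `∇_a u(t)`, at the time `t` of the interval `J`, of the path
`u` in the bundle `V` along the `A`-path `a` in `A`, both over the base path `q`:
for some time-dependent sections `ξ` of `A` and `η` of `V` with `ξ(s, q(s)) = a(s)` and
`η(s, q(s)) = u(s)` for `s ∈ J`, where `η` is jointly `C¹` at `(t, q(t))`,
one has `w = ∂_t η(t, q(t)) + (∇_ξ η)(t, q(t))`, the operator `∇` acting on the sections obtained
by freezing the time. The section `ξ` is never differentiated, so nothing is required of its
dependence on time; the value `w` does not depend on `ξ` and `η`. -/
def AConnection.IsCovDerivAlong {L : LieAlgebroid E F A} (D : AConnection G V L) (J : Set ℝ)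
    (q : ℝ → Q) (a : ∀ t, A (q t)) (u : ∀ t, V (q t)) (t : ℝ) (w : V (q t)) : Prop :=
  ∃ (ξ : ℝ → Sec E F A) (η : ℝ → Sec E G V) (η' : V (q t)),
    (∀ s ∈ J, ξ s (q s) = a s) ∧ (∀ s ∈ J, η s (q s) = u s) ∧
    ContMDiffWithinAt (𝓘(ℝ, ℝ).prod 𝓘(ℝ, E)) (𝓘(ℝ, E).prod 𝓘(ℝ, G)) 1
      (fun z : ℝ × Q => (⟨z.2, η z.1 z.2⟩ : TotalSpace G V)) (J ×ˢ univ) (t, q t) ∧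
    HasDerivWithinAt (fun s => η s (q t)) η' J t ∧
    w = η' + D.toFun (ξ t) (η t) (q t)

end Along
end LiePoisson

end

noncomputable section
set_option linter.unusedSectionVars false
namespace LiePoisson

/-! Every covector at a point of `A*` is the differential of some `Φ_X + f ∘ π`, so a tangent vector
is known once it is tested on the fibrewise linear functions `Φ_X` and on the pullbacks `f ∘ π`.
Hamilton's equation splits accordingly. Fix a time and write `dH(p) = d(Φ_Y + g ∘ π)(p)`, so that
`Y(q) = dH^ver(p)`.

Testing on pullbacks gives `q̇ = -ε ρ(Y) = ρ(a)`, the anchor equation (`eq_hamiltonianVF_iff`).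
Testing on `Φ_X` gives `d/dt ⟨p, X(q)⟩ = ε(⟨p, [X, Y]⟩ + ρ(X)[g])`.

The second condition is rewritten with the connection. Since `⟨dH^hor, v⟩ = ⟨p, ∇_v Y⟩ + v[g]`
(`hor_dPhi`) and `∇̄_Y X = ∇_{ρ(X)} Y + [Y, X]`, its right side is `ε(⟨ρ* dH^hor, X⟩ - ⟨p, ∇̄_Y X⟩)`
(`bracketForm_eq_hor_sub_bar`). Once the anchor equation holds, the product rule
(`hasDerivWithinAt_pair`) turns the left side into `⟨∇̄*_a p, X⟩ + ⟨p, ∇̄_a X⟩`. As `a = -ε Y(q)`,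
the `∇̄` terms cancel, leaving `⟨∇̄*_a p, X⟩ = ε⟨ρ* dH^hor, X⟩` for all `X`.

Because the covariant derivative along `a` is defined through extensions, deriving the second
equation also requires that a `C¹` path admits one; this is `exists_timeDependent_extension`. -/

/-! ### Velocities of curves -/

theorem smulRight_one_injective (W : Type*) [AddCommGroup W] [Module ℝ W] [TopologicalSpace W]
    [ContinuousSMul ℝ W] :
    Function.Injective (ContinuousLinearMap.smulRight (1 : ℝ →L[ℝ] ℝ) : W → ℝ →L[ℝ] W) :=
  fun v v' h => (one_smul ℝ v).symm.trans ((congrArg (fun l => l 1) h).trans (one_smul ℝ v'))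

/-- Differentiation of curves in topological vector spaces commutes with continuous linear maps. -/
theorem hasDerivWithinAt_clm_comp {U W : Type*} [AddCommGroup U] [Module ℝ U] [TopologicalSpace U]
    [ContinuousSMul ℝ U] [AddCommGroup W] [Module ℝ W] [TopologicalSpace W] [ContinuousSMul ℝ W]
    (T : U →L[ℝ] W) {g : ℝ → U} {g' : U} {s : Set ℝ} {t : ℝ} (h : HasDerivWithinAt g g' s t) :
    HasDerivWithinAt (fun r => T (g r)) (T g') s t := by
  refine ⟨?_⟩
  -- The fibres of a bundle carry a topology but no chosen norm, so the argument works with the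
  -- remainder itself: the remainder of `T ∘ g` is `T` of the remainder of `g`, and a continuous
  -- linear map preserves little-o.
  have h1 := (T.isBigOTVS_comp (l := 𝓝[s] t ×ˢ pure t)
    (f := fun p : ℝ × ℝ => g p.1 - g p.2 - (p.1 - p.2) • g')).trans_isLittleOTVS
    (by simpa using h.isLittleOTVS)
  refine h1.congr_left fun p => ?_
  simp

/-- A curve through a differentiable map, in terms of its velocity. -/
theorem hasDerivWithinAt_comp_curve {E₁ : Type*} [NormedAddCommGroup E₁] [NormedSpace ℝ E₁]
    {H₁ : Type*} [TopologicalSpace H₁] {I : ModelWithCorners ℝ E₁ H₁}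
    {M : Type*} [TopologicalSpace M] [ChartedSpace H₁ M] {f : M → ℝ} {c : ℝ → M} {s : Set ℝ}
    {S : Set M} {t : ℝ} {w : TangentSpace I (c t)} {f' : TangentSpace I (c t) →L[ℝ] ℝ}
    (hf : HasMFDerivWithinAt I 𝓘(ℝ) f S (c t) f')
    (hc : HasMFDerivWithinAt 𝓘(ℝ, ℝ) I c s t
      (ContinuousLinearMap.smulRight (1 : ℝ →L[ℝ] ℝ) w)) (hS : MapsTo c s S) :
    HasDerivWithinAt (fun r => f (c r)) (f' w) s t := by
  have h : HasFDerivWithinAt (fun r => f (c r)) (show ℝ →L[ℝ] ℝ from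
    f'.comp (ContinuousLinearMap.smulRight (1 : ℝ →L[ℝ] ℝ) w)) s t :=
    (hf.comp t hc hS).hasFDerivWithinAt
  exact h.hasDerivWithinAt.congr_deriv (congrArg f' (one_smul ℝ w))

/-! ### Separating tangent vectors, and extending curves to time-dependent sections -/

section Sections
variable {E : Type*} [NormedAddCommGroup E] [NormedSpace ℝ E]
  {Q : Type*} [TopologicalSpace Q] [ChartedSpace E Q]
  {G : Type*} [NormedAddCommGroup G] [NormedSpace ℝ G]
  {V : Q → Type*} [TopologicalSpace (TotalSpace G V)]
  [∀ q, AddCommGroup (V q)] [∀ q, Module ℝ (V q)] [∀ q, TopologicalSpace (V q)]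
  [∀ q, ContinuousSMul ℝ (V q)]
  [FiberBundle G V] [VectorBundle ℝ G V]
  [FiniteDimensional ℝ E] [T2Space Q] [IsManifold 𝓘(ℝ, E) ∞ Q]
  [ContMDiffVectorBundle ∞ G V 𝓘(ℝ, E)]

/-- A function on `Q` may have any prescribed differential at a point. -/
theorem exists_fn_dirDeriv_eq (q : Q) (l : TangentSpace 𝓘(ℝ, E) q →L[ℝ] ℝ) :
    ∃ f : Fn E Q, ∀ v : TangentSpace 𝓘(ℝ, E) q, dirDeriv v f = l v := by
  let l' : E →L[ℝ] ℝ := l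
  obtain ⟨ψ⟩ : Nonempty (SmoothBumpFunction 𝓘(ℝ, E) q) := inferInstance
  let f : Fn E Q := ⟨fun x => ψ x • l' (extChartAt 𝓘(ℝ, E) q x), ψ.contMDiff_smul
    (l'.contMDiff.comp_contMDiffOn (contMDiffOn_extChartAt (n := ∞)))⟩
  have key : f =ᶠ[𝓝 q] fun x => l' (extChartAt 𝓘(ℝ, E) q x) := by
    filter_upwards [ψ.eventuallyEq_one] with x hx
    change ψ x • l' (extChartAt 𝓘(ℝ, E) q x) = _
    rw [hx, Pi.one_apply, one_smul]
  -- Written in the chart at `q` this function is `l'` itself near the image of `q`, so its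
  -- differential at `q` is `l`.
  have h2 : HasMFDerivAt 𝓘(ℝ, E) 𝓘(ℝ) (fun x => l' (extChartAt 𝓘(ℝ, E) q x)) q l := by
    refine ⟨l'.continuous.continuousAt.comp (continuousAt_extChartAt q), ?_⟩
    have : HasFDerivWithinAt (fun x => l' x) l' (range 𝓘(ℝ, E)) (extChartAt 𝓘(ℝ, E) q q) :=
      l'.hasFDerivAt.hasFDerivWithinAt
    refine this.congr_of_eventuallyEq ?_ ?_
    · filter_upwards [extChartAt_target_mem_nhdsWithin (I := 𝓘(ℝ, E)) q] with x hx
      exact congrArg l' ((extChartAt 𝓘(ℝ, E) q).right_inv hx)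
    · exact congrArg (fun z => l' (extChartAt 𝓘(ℝ, E) q z)) (extChartAt_to_inv (I := 𝓘(ℝ, E)) q)
  refine ⟨f, fun v => ?_⟩
  have h4 : mfderiv 𝓘(ℝ, E) 𝓘(ℝ) f q = l := (h2.congr_of_eventuallyEq key).mfderiv
  unfold dirDeriv mvfderiv
  rw [h4]
  rfl

/-- Linear functionals separate points of the finite-dimensional tangent space, and each of them is
the differential of a global function. -/
theorem tangent_ext {q : Q} {v w : TangentSpace 𝓘(ℝ, E) q}
    (h : ∀ f : Fn E Q, dirDeriv v f = dirDeriv w f) : v = w := by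
  refine (SeparatingDual.eq_iff_forall_dual_eq (R := ℝ) (V := E) (x := v) (y := w)).2 fun l => ?_
  obtain ⟨f, hf⟩ := exists_fn_dirDeriv_eq (E := E) q l
  exact (hf v).symm.trans ((h f).trans (hf w))

/-- A `C¹` curve in a vector bundle extends, near a given time, to a time-dependent section. -/
theorem exists_timeDependent_extension {J : Set ℝ} {t : ℝ} (ht : t ∈ J) {u : ℝ → TotalSpace G V}
    (hu : ContMDiffWithinAt 𝓘(ℝ, ℝ) (𝓘(ℝ, E).prod 𝓘(ℝ, G)) 1 u J t) :
    ∃ (η : ℝ → Sec E G V) (η' : V (u t).proj), (∀ s, η s (u s).proj = (u s).2) ∧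
      ContMDiffWithinAt (𝓘(ℝ, ℝ).prod 𝓘(ℝ, E)) (𝓘(ℝ, E).prod 𝓘(ℝ, G)) 1
        (fun z : ℝ × Q => (⟨z.2, η z.1 z.2⟩ : TotalSpace G V)) (J ×ˢ univ) (t, (u t).proj) ∧
      HasDerivWithinAt (fun s => η s (u t).proj) η' J t := by
  classical
  set q := (u t).proj with hq0
  set e := trivializationAt G V q with he
  have hq : q ∈ e.baseSet := FiberBundle.mem_baseSet_trivializationAt G V q
  obtain ⟨f, hf⟩ := exists_bump (E := E) (e.open_baseSet.mem_nhds hq)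
  -- The candidates for a frozen-time extension: the section with constant coordinate `g` in the
  -- trivialization at `q`, cut off by the bump function.
  have hS : ∀ g : G, ∃ S : Sec E G V, ∀ x, S x = f x • e.symm x g := by
    intro g
    have hs : ContMDiffOn 𝓘(ℝ, E) (𝓘(ℝ, E).prod 𝓘(ℝ, G)) ∞
        (fun x => TotalSpace.mk' G x (e.symm x g)) e.baseSet := by
      rw [e.contMDiffOn_section_baseSet_iff]
      apply (contMDiffOn_const (c := g)).congr
      intro y hy
      rw [e.apply_mk_symm hy]
    exact ⟨⟨_, ContMDiffOn.smul_section_of_tsupport f.contMDiff.contMDiffOn e.open_baseSet hf hs⟩,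
      fun x => rfl⟩
  choose S hS using hS
  choose T hT using fun s => exists_section_through E G (u s).proj (u s).2
  obtain ⟨hu1, hu2⟩ := contMDiffWithinAt_totalSpace.1 hu
  -- The cut-off section reproduces the fibre value only where the bump function equals one. That
  -- holds for all times in `J` close to `t`; at any other time the arbitrary section `T s` through
  -- the curve takes over, with no effect on the behaviour at `t`.
  let η : ℝ → Sec E G V := fun s => if f (u s).proj = 1 then S (e (u s)).2 else T s
  have hev : ∀ᶠ s in 𝓝[J] t, η s = S (e (u s)).2 := by
    have h1 : ∀ᶠ s in 𝓝[J] t, f (u s).proj = 1 :=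
      hu1.continuousWithinAt.tendsto.eventually f.eventuallyEq_one
    filter_upwards [h1] with s hs
    exact if_pos hs
  have hηt := hev.self_of_nhdsWithin ht
  have hfib : ∀ s, f (u s).proj = 1 → η s (u s).proj = (u s).2 := by
    intro s hs
    have hb : (u s).proj ∈ e.baseSet := hf (subset_tsupport _ (by simp [hs]))
    change (if f (u s).proj = 1 then S (e (u s)).2 else T s) (u s).proj = _
    rw [if_pos hs, hS, hs, one_smul]
    exact e.symm_apply_apply_mk hb (u s).2
  -- The time derivative at the fixed point `q` is the derivative of the fibre coordinate of `u`,
  -- carried back to the fibre over `q` by the trivialization.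
  refine ⟨η, e.symmL ℝ q (derivWithin (fun s => (e (u s)).2) J t), fun s => ?_, ?_, ?_⟩
  · by_cases hs : f (u s).proj = 1
    · exact hfib s hs
    · change (if f (u s).proj = 1 then S (e (u s)).2 else T s) (u s).proj = _
      rw [if_neg hs, hT]
  · rw [contMDiffWithinAt_totalSpace]
    refine ⟨contMDiffWithinAt_snd, ?_⟩
    -- In the trivialization, `η` near `(t, q)` is a smooth function of the point times a `C¹`
    -- function of the time, so joint regularity is immediate.
    have h1 : ContMDiffWithinAt (𝓘(ℝ, ℝ).prod 𝓘(ℝ, E)) 𝓘(ℝ, G) 1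
        (fun z : ℝ × Q => f z.2 • (e (u z.1)).2) (J ×ˢ univ) (t, q) := by
      have hf1 : ContMDiffWithinAt (𝓘(ℝ, ℝ).prod 𝓘(ℝ, E)) 𝓘(ℝ) 1
          (fun z : ℝ × Q => f z.2) (J ×ˢ univ) (t, q) :=
        (((f.contMDiff : ContMDiff _ _ ∞ f).of_le (by simp)).contMDiffAt.comp (t, q)
          contMDiffAt_snd).contMDiffWithinAt
      have hg1 : ContMDiffWithinAt (𝓘(ℝ, ℝ).prod 𝓘(ℝ, E)) 𝓘(ℝ, G) 1
          (fun z : ℝ × Q => (e (u z.1)).2) (J ×ˢ univ) (t, q) :=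
        ContMDiffWithinAt.comp (t, q) (t := J) (g := fun s => (e (u s)).2) hu2
          contMDiffWithinAt_fst (fun z hz => hz.1)
      exact hf1.smul hg1
    have h2 : ∀ z : ℝ × Q, η z.1 = S (e (u z.1)).2 → z.2 ∈ e.baseSet →
        (e ⟨z.2, η z.1 z.2⟩).2 = f z.2 • (e (u z.1)).2 := by
      intro z h h'
      rw [h, hS, (e.linear ℝ h').map_smul]
      congr 1
      rw [← TotalSpace.mk', e.apply_mk_symm h']
    refine h1.congr_of_eventuallyEq ?_ (h2 (t, q) hηt hq)
    have h3 : Filter.Tendsto Prod.fst (𝓝[J ×ˢ univ] (t, q)) (𝓝[J] t) :=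
      tendsto_nhdsWithin_of_tendsto_nhds_of_eventually_within _
        (continuous_fst.tendsto' _ _ rfl |>.mono_left nhdsWithin_le_nhds)
        (eventually_mem_nhdsWithin.mono fun z hz => hz.1)
    have h4 : Filter.Tendsto Prod.snd (𝓝[J ×ˢ univ] (t, q)) (𝓝 q) :=
      continuous_snd.tendsto' _ _ rfl |>.mono_left nhdsWithin_le_nhds
    filter_upwards [h3.eventually hev, h4.eventually (e.open_baseSet.mem_nhds hq)] with z hz hz'
    exact h2 z hz hz'
  · have hd : HasDerivWithinAt (fun s => (e (u s)).2)
        (derivWithin (fun s => (e (u s)).2) J t) J t :=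
      (hu2.mdifferentiableWithinAt (by simp)).differentiableWithinAt.hasDerivWithinAt
    have h1 := hasDerivWithinAt_clm_comp (e.symmL ℝ q) hd
    -- At `q` the bump function is one, so near `t` the curve `η s q` is the fibre coordinate of `u
    -- s` read in the fibre over `q`.
    refine HasFDerivWithinAt.congr_of_eventuallyEq h1 ?_ ?_
    · filter_upwards [hev] with s hs
      rw [hs, hS, f.eq_one, one_smul, e.symmL_apply hq]
    · rw [hηt, hS, f.eq_one, one_smul, e.symmL_apply hq]

end Sections

/-! ### Covariant derivatives along `A`-paths -/

section Along
variable {E : Type*} [NormedAddCommGroup E] [NormedSpace ℝ E] [FiniteDimensional ℝ E]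
  {Q : Type*} [TopologicalSpace Q] [ChartedSpace E Q] [IsManifold 𝓘(ℝ, E) ∞ Q] [T2Space Q]
  {F : Type*} [NormedAddCommGroup F] [NormedSpace ℝ F] [FiniteDimensional ℝ F]
  {A : Q → Type*} [TopologicalSpace (TotalSpace F A)]
  [∀ q, AddCommGroup (A q)] [∀ q, Module ℝ (A q)] [∀ q, TopologicalSpace (A q)]
  [FiberBundle F A] [VectorBundle ℝ F A] [ContMDiffVectorBundle ∞ F A 𝓘(ℝ, E)]
  {G : Type*} [NormedAddCommGroup G] [NormedSpace ℝ G] [FiniteDimensional ℝ G]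
  {V : Q → Type*} [TopologicalSpace (TotalSpace G V)]
  [∀ q, AddCommGroup (V q)] [∀ q, Module ℝ (V q)] [∀ q, TopologicalSpace (V q)]
  [∀ q, ContinuousSMul ℝ (V q)]
  [FiberBundle G V] [VectorBundle ℝ G V] [ContMDiffVectorBundle ∞ G V 𝓘(ℝ, E)]

namespace AConnection
variable {L : LieAlgebroid E F A}

/-- The value `(∇_X s)(q)` depends on `X` only through `X(q)`. -/
theorem toFun_congr_left (D : AConnection G V L) {X Y : Sec E F A} {q : Q} (h : X q = Y q)
    (s : Sec E G V) : D.toFun X s q = D.toFun Y s q := by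
  -- `C^∞(Q)`-linearity in the first slot, applied to the section `X - Y` vanishing at `q`.
  have h0 := tensorial_eq_zero (q := q) (fun X : Sec E F A => D.toFun X s q)
    (fun X Y => by simp) (fun f X => D.mul_left f X s q) (X - Y) (by simp [h])
  rw [map_sub, LinearMap.sub_apply, ContMDiffSection.coe_sub, Pi.sub_apply] at h0
  exact sub_eq_zero.1 h0

/-- The regularity demanded of `η` is provided by extending the `C¹` path `u`. No regularity in time
is demanded of `ξ`, so sections through the `a s` can be chosen independently of one another. -/
theorem IsCovDerivAlong.of_extension (D : AConnection G V L) {J : Set ℝ} {q : ℝ → Q}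
    (a : ∀ t, A (q t)) {u : ∀ t, V (q t)} {t : ℝ} (ht : t ∈ J)
    (hu : ContMDiffWithinAt 𝓘(ℝ, ℝ) (𝓘(ℝ, E).prod 𝓘(ℝ, G)) 1
      (fun s => (⟨q s, u s⟩ : TotalSpace G V)) J t) :
    ∃ w, D.IsCovDerivAlong J q a u t w := by
  obtain ⟨η, η', h1, h2, h3⟩ := exists_timeDependent_extension ht hu
  choose ξ hξ using fun s => exists_section_through E F (q s) (a s)
  exact ⟨_, ξ, η, η', fun s _ => hξ s, fun s _ => h1 s, h2, h3, rfl⟩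

/-- The product rule for the covariant derivative of a path in the dual bundle along an
`A`-path. -/
theorem IsCovDerivAlong.hasDerivWithinAt_pair {D : AConnection G V L} {J : Set ℝ} {q : ℝ → Q}
    {a : ∀ t, A (q t)} {u : ∀ t, DualBundle V (q t)} {t : ℝ} {w : DualBundle V (q t)}
    (h : D.dual.IsCovDerivAlong J q a u t w) (hJ : UniqueDiffWithinAt ℝ J t) (ht : t ∈ J)
    (hq : HasMFDerivWithinAt 𝓘(ℝ, ℝ) 𝓘(ℝ, E) q J t
      (ContinuousLinearMap.smulRight (1 : ℝ →L[ℝ] ℝ) (L.anchor (q t) (a t))))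
    {X : Sec E F A} (hX : X (q t) = a t) (s : Sec E G V) :
    HasDerivWithinAt (fun r => pair (u r) (s (q r)))
      (pair w (s (q t)) + pair (u t) (D.toFun X s (q t))) J t := by
  obtain ⟨ξ, η, η', hξ, hη, hsm, hd, rfl⟩ := h
  -- The pairing as a function of independent time and position. Its derivative along `r ↦ (r, q r)`
  -- is the sum of its two partial derivatives: the time one sees `∂_t η`, the spatial one sees the
  -- section `η t` frozen at `t`.
  let Γ : ℝ × Q → ℝ := fun z => pair (η z.1 z.2) (s z.2)
  have hΓ : MDifferentiableWithinAt (𝓘(ℝ, ℝ).prod 𝓘(ℝ, E)) 𝓘(ℝ) Γ (J ×ˢ univ) (t, q t) := by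
    have hs : ContMDiffWithinAt (𝓘(ℝ, ℝ).prod 𝓘(ℝ, E)) (𝓘(ℝ, E).prod 𝓘(ℝ, G)) 1
        (fun z : ℝ × Q => TotalSpace.mk' G z.2 (s z.2)) (J ×ˢ univ) (t, q t) :=
      ((s.contMDiff.of_le (by simp)).contMDiffAt.comp (t, q t) contMDiffAt_snd).contMDiffWithinAt
    have h3 := hsm.clm_bundle_apply (F₂ := ℝ) (E₂ := Bundle.Trivial Q ℝ) hs
    exact ((contMDiffWithinAt_totalSpace.1 h3).2).mdifferentiableWithinAt (by simp)
  let dΓ : ℝ × E →L[ℝ] ℝ :=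
    mfderivWithin (𝓘(ℝ, ℝ).prod 𝓘(ℝ, E)) 𝓘(ℝ) Γ (J ×ˢ univ) (t, q t)
  have hΓ' : HasMFDerivWithinAt (𝓘(ℝ, ℝ).prod 𝓘(ℝ, E)) 𝓘(ℝ) Γ (J ×ˢ univ) (t, q t) dΓ :=
    hΓ.hasMFDerivWithinAt
  let v : E := L.anchor (q t) (a t)
  have htime : dΓ (1, 0) = pair η' (s (q t)) := by
    have hc : HasMFDerivWithinAt 𝓘(ℝ, ℝ) (𝓘(ℝ, ℝ).prod 𝓘(ℝ, E)) (fun r : ℝ => (r, q t)) J t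
        (ContinuousLinearMap.smulRight (1 : ℝ →L[ℝ] ℝ) ((1, 0) : ℝ × E)) := by
      refine ((hasMFDerivWithinAt_id J t).prodMk (hasMFDerivWithinAt_const (q t) J t)).congr_mfderiv ?_
      exact ContinuousLinearMap.ext fun r : ℝ =>
        Prod.ext (mul_one r).symm (smul_zero (A := E) r).symm
    have h1 := hasDerivWithinAt_comp_curve (S := J ×ˢ univ) hΓ' hc fun r hr => ⟨hr, mem_univ _⟩
    -- Evaluation at `s (q t)` is continuous on the dual fibre, so it may be applied to the
    -- derivative `η'`.
    let T : DualBundle V (q t) →L[ℝ] ℝ :=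
      { toFun := fun φ => pair φ (s (q t))
        map_add' := fun _ _ => rfl
        map_smul' := fun _ _ => rfl
        cont := continuous_eval_const (s (q t)) }
    have h2 := hasDerivWithinAt_clm_comp T hd
    exact hJ.eq_deriv _ h1 h2
  have hspace : dΓ (0, v) = dirDeriv (L.anchor (q t) (a t)) (pairing (η t) s) := by
    have hc : HasMFDerivWithinAt 𝓘(ℝ, E) (𝓘(ℝ, ℝ).prod 𝓘(ℝ, E)) (fun x : Q => (t, x)) univ (q t)
        (ContinuousLinearMap.inr ℝ ℝ E) :=
      (hasMFDerivWithinAt_const t univ (q t)).prodMk (hasMFDerivWithinAt_id univ (q t))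
    -- Since `t ∈ J`, the whole slice `{t} × Q` lies in the set on which `Γ` is differentiated, so
    -- the spatial derivative is an ordinary one.
    have h1 := hΓ'.comp (q t) hc fun x _ => ⟨ht, mem_univ _⟩
    have h2 := (fn_mdiff (pairing (η t) s) (q t)).hasMFDerivAt
    have h3 := hasMFDerivAt_unique (hasMFDerivWithinAt_univ.1 h1) h2
    exact congrArg (fun l : E →L[ℝ] ℝ => l v) h3
  have hcurve : HasDerivWithinAt (fun r => Γ (r, q r)) (dΓ (1, v)) J t := by
    have hc : HasMFDerivWithinAt 𝓘(ℝ, ℝ) (𝓘(ℝ, ℝ).prod 𝓘(ℝ, E)) (fun r : ℝ => (r, q r)) J t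
        (ContinuousLinearMap.smulRight (1 : ℝ →L[ℝ] ℝ) ((1, v) : ℝ × E)) := by
      refine ((hasMFDerivWithinAt_id J t).prodMk hq).congr_mfderiv ?_
      exact ContinuousLinearMap.ext fun r : ℝ => Prod.ext (mul_one r).symm rfl
    exact hasDerivWithinAt_comp_curve (S := J ×ˢ univ) hΓ' hc fun r hr => ⟨hr, mem_univ _⟩
  have hsum : dΓ (1, v) = dΓ (1, 0) + dΓ (0, v) := by
    rw [← map_add]; simp
  -- The defining identity of the dual connection at the frozen time: it trades `ρ(a)[⟨η, s⟩]` for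
  -- `⟨∇*_ξ η, s⟩ + ⟨u, ∇_ξ s⟩`, and tensoriality lets `X` replace `ξ t` in the last term.
  have hdual := D.dualFun_apply (ξ t) (η t) (q t) s
  have hcongr : D.toFun (ξ t) s (q t) = D.toFun X s (q t) :=
    D.toFun_congr_left ((hξ t ht).trans hX.symm) s
  rw [hcongr, hξ t ht, hη t ht] at hdual
  have h2 : pair (η' + D.dual.toFun (ξ t) (η t) (q t)) (s (q t)) =
      pair η' (s (q t)) + pair (D.dualFun (ξ t) (η t) (q t)) (s (q t)) := rfl
  rw [h2, hdual, ← htime, ← hspace, add_assoc, sub_add_cancel, ← hsum]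
  -- `η` extends `u` only at times in `J`, which suffices for a derivative within `J`.
  refine hcurve.congr_of_eventuallyEq_of_mem ?_ ht
  filter_upwards [self_mem_nhdsWithin] with r hr
  exact congrArg (fun φ => pair φ (s (q r))) (hη r hr).symm

end AConnection
end Along

/-! ### Splitting Hamilton's equation into base and fibrewise linear parts -/

section Hamiltonian
variable {E : Type*} [NormedAddCommGroup E] [NormedSpace ℝ E] [FiniteDimensional ℝ E]
  {Q : Type*} [TopologicalSpace Q] [ChartedSpace E Q] [IsManifold 𝓘(ℝ, E) ∞ Q] [T2Space Q]
  {F : Type*} [NormedAddCommGroup F] [NormedSpace ℝ F] [FiniteDimensional ℝ F]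
  {A : Q → Type*} [TopologicalSpace (TotalSpace F A)]
  [∀ q, AddCommGroup (A q)] [∀ q, Module ℝ (A q)] [∀ q, TopologicalSpace (A q)]
  [∀ q, IsTopologicalAddGroup (A q)] [∀ q, ContinuousSMul ℝ (A q)]
  [FiberBundle F A] [VectorBundle ℝ F A] [ContMDiffVectorBundle ∞ F A 𝓘(ℝ, E)]

/-- The differentials `dPhi p X f` exhaust the covectors at `p`, and covectors separate tangent
vectors. -/
theorem eq_of_forall_dPhi {p : DualTot F A} {v w : TangentSpace (DualModel E F) p}
    (h : ∀ (X : Sec E F A) (f : Fn E Q), dPhi p X f v = dPhi p X f w) : v = w := by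
  refine (SeparatingDual.eq_iff_forall_dual_eq (R := ℝ) (V := E × (F →L[ℝ] ℝ))
    (x := v) (y := w)).2 fun l => ?_
  obtain ⟨X, f, hf⟩ := exists_dPhi_eq p (show TangentSpace (DualModel E F) p →L[ℝ] ℝ from l)
  have := h X f
  rw [hf] at this
  exact this

/-- The tangent map of the projection `π : A* → Q`. -/
def tangentProj (p : DualTot F A) (w : TangentSpace (DualModel E F) p) :
    TangentSpace 𝓘(ℝ, E) p.proj :=
  mfderiv (DualModel E F) 𝓘(ℝ, E) (fun p' : DualTot F A => p'.proj) p w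

theorem hasMFDerivAt_proj (p : DualTot F A) :
    HasMFDerivAt (DualModel E F) 𝓘(ℝ, E) (fun p' : DualTot F A => p'.proj) p
      (mfderiv (DualModel E F) 𝓘(ℝ, E) (fun p' : DualTot F A => p'.proj) p) :=
  ((contMDiff_proj (n := ∞) (IB := 𝓘(ℝ, E)) (F := F →L[ℝ] ℝ) (DualBundle A)).mdifferentiable
    (by simp) p).hasMFDerivAt

theorem hasMFDerivWithinAt_proj_curve {p : ℝ → DualTot F A} {J : Set ℝ} {t : ℝ}
    {w : TangentSpace (DualModel E F) (p t)}
    (h : HasMFDerivWithinAt 𝓘(ℝ, ℝ) (DualModel E F) p J t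
      (ContinuousLinearMap.smulRight (1 : ℝ →L[ℝ] ℝ) w)) :
    HasMFDerivWithinAt 𝓘(ℝ, ℝ) 𝓘(ℝ, E) (fun s => (p s).proj) J t
      (ContinuousLinearMap.smulRight (1 : ℝ →L[ℝ] ℝ) (tangentProj (p t) w)) := by
  refine ((hasMFDerivAt_proj (p t)).comp_hasMFDerivWithinAt t h).congr_mfderiv ?_
  exact ContinuousLinearMap.ext fun r : ℝ =>
    map_smul (mfderiv (DualModel E F) 𝓘(ℝ, E) (fun p' : DualTot F A => p'.proj) (p t)) r w

/-- The chain rule for `f ∘ π`: pullbacks see exactly the projection of `w` to the base. -/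
theorem dPhi_pullback_apply (p : DualTot F A) (f : Fn E Q) (w : TangentSpace (DualModel E F) p) :
    dPhi p 0 f w = dirDeriv (tangentProj p w) f := by
  rw [← dH_pullback]
  have h1 := (fn_mdiff f p.proj).hasMFDerivAt.comp p (hasMFDerivAt_proj (E := E) p)
  have h2 : mfderiv (DualModel E F) 𝓘(ℝ) (pullback (A := A) f) p = _ := h1.mfderiv
  unfold dH mvfderiv
  rw [h2]
  rfl

theorem dPhi_eq_add (p : DualTot F A) (X : Sec E F A) (f : Fn E Q)
    (w : TangentSpace (DualModel E F) p) : dPhi p X f w = dPhi p X 0 w + dPhi p 0 f w := by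
  rw [← dH_Phi, ← dH_pullback]
  have h1 := mvfderiv_add (I := DualModel E F)
    ((Phi (E := E) X).contMDiff.mdifferentiable (by simp) p)
    ((pullback (A := A) f).contMDiff.mdifferentiable (by simp) p)
  exact congrArg (fun l => l w) h1

/-- In `H_p v = Tμ(v) - V_p(∇*_v μ)` the first term contributes `v[⟨μ, X⟩] + v[f]` and the second
`v[⟨μ, X⟩] - ⟨p, ∇_v X⟩`; the derivative of `⟨μ, X⟩`, and with it the choice of `μ`, drops out. -/
theorem hor_dPhi (N : CovariantDerivative 𝓘(ℝ, E) F A) (p : DualTot F A) (X : Sec E F A)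
    (f : Fn E Q) (v : TangentSpace 𝓘(ℝ, E) p.proj) :
    hor N p (dPhi p X f) v = pair p.2 (N X p.proj v) + dirDeriv v f := by
  have h1 := dualCov_apply N p.proj (secThrough p) v X
  rw [secThrough_apply] at h1
  change dPhi p X f (horLift N p v) = _
  rw [horLift, ContinuousLinearMap.map_sub, dPhi_vertLift,
    dPhi_tangentAt _ _ _ _ (secThrough_apply p), h1]
  ring

namespace LieAlgebroid
variable (L : LieAlgebroid E F A)

theorem bracketForm_eq_sub (p : DualTot F A) (X : Sec E F A) (f : Fn E Q) (Y : Sec E F A)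
    (g : Fn E Q) : L.bracketForm p X f Y g =
      L.bracketForm p X 0 Y g - dirDeriv (L.anchor p.proj (Y p.proj)) f := by
  have h : ∀ v : TangentSpace 𝓘(ℝ, E) p.proj, dirDeriv v (0 : Fn E Q) = 0 := fun v =>
    dirDeriv_const v 0
  simp only [bracketForm, h, sub_zero]

/-- The form is the differential of `Φ_0 + 0 ∘ π = 0` evaluated on a tangent vector. -/
theorem bracketForm_zero_left (p : DualTot F A) (Y : Sec E F A) (g : Fn E Q) :
    L.bracketForm p 0 0 Y g = 0 := by
  obtain ⟨v, hv⟩ := L.exists_hamVec p Y g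
  rw [← hv, dPhi_pullback_apply]
  exact dirDeriv_const _ 0

/-- The Hamiltonian vector field in terms of its projection to `Q` and its action on fibrewise
linear functions. -/
theorem eq_hamiltonianVF_iff (ε : ℝ) (H : C^∞⟮DualModel E F, DualTot F A; ℝ⟯) (p : DualTot F A)
    (Y : Sec E F A) (g : Fn E Q) (hH : dPhi p Y g = dH H p)
    (w : TangentSpace (DualModel E F) p) :
    w = L.hamiltonianVF ε H p ↔
      tangentProj p w = L.anchor p.proj (-(ε • ver p (dH H p))) ∧
      ∀ X : Sec E F A, dPhi p X 0 w = ε * L.bracketForm p X 0 Y g := by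
  have hver : ver p (dH H p) = Y p.proj := by rw [← hH, ver_dPhi]
  have hham : ∀ (X : Sec E F A) (f : Fn E Q), dPhi p X f (L.hamiltonianVF ε H p) =
      ε * L.bracketForm p X f Y g := fun X f => by
    rw [apply_hamiltonianVF, ← hH, poissonTensor_dPhi]
  -- The right side is the `f`-dependent part of `ε` times the bracket form; this is where the sign
  -- in `a = -ε dH^ver` originates.
  have hdir : ∀ f : Fn E Q, dirDeriv (L.anchor p.proj (-(ε • ver p (dH H p)))) f =
      - (ε * dirDeriv (L.anchor p.proj (Y p.proj)) f) := fun f => by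
    rw [hver, map_neg, map_smul]
    exact (map_neg (mvfderiv 𝓘(ℝ, E) f p.proj) _).trans
      (congrArg Neg.neg (map_smul (mvfderiv 𝓘(ℝ, E) f p.proj) ε _))
  constructor
  · rintro rfl
    -- Testing on pullbacks, that is with `X = 0`, identifies the projection; testing with `f = 0`
    -- is the second condition.
    refine ⟨tangent_ext fun f => ?_, fun X => hham X 0⟩
    rw [← dPhi_pullback_apply, hham, hdir, bracketForm_eq_sub, bracketForm_zero_left]
    ring
  · rintro ⟨h1, h2⟩
    -- Both sides are additive in the pair `(X, f)`, so agreement on `Φ_X` and on `f ∘ π` separately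
    -- is enough.
    refine eq_of_forall_dPhi fun X f => ?_
    rw [hham, dPhi_eq_add, dPhi_pullback_apply, h1, h2, hdir, bracketForm_eq_sub L p X f]
    ring

end LieAlgebroid

end Hamiltonian

/-! ### The covariant form of Hamilton's equation -/

section Equation
variable {E : Type*} [NormedAddCommGroup E] [NormedSpace ℝ E] [FiniteDimensional ℝ E]
  {Q : Type*} [TopologicalSpace Q] [ChartedSpace E Q] [IsManifold 𝓘(ℝ, E) ∞ Q] [T2Space Q]
  {F : Type*} [NormedAddCommGroup F] [NormedSpace ℝ F] [FiniteDimensional ℝ F]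
  {A : Q → Type*} [TopologicalSpace (TotalSpace F A)]
  [∀ q, AddCommGroup (A q)] [∀ q, Module ℝ (A q)] [∀ q, TopologicalSpace (A q)]
  [∀ q, IsTopologicalAddGroup (A q)] [∀ q, ContinuousSMul ℝ (A q)]
  [FiberBundle F A] [VectorBundle ℝ F A] [ContMDiffVectorBundle ∞ F A 𝓘(ℝ, E)]

/-- A nondegenerate interval is convex with nonempty interior. Uniqueness of derivatives within it,
endpoints included, is what allows velocities to be compared. -/
theorem uniqueDiffOn_of_ordConnected {J : Set ℝ} (hJ : J.OrdConnected) (hJ' : J.Nontrivial) :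
    UniqueDiffOn ℝ J :=
  uniqueDiffOn_convex hJ.convex (hJ.convex.nontrivial_iff_nonempty_interior.1 hJ')

theorem hasDerivWithinAt_Phi_curve {p : ℝ → DualTot F A} {J : Set ℝ} {t : ℝ}
    {w : TangentSpace (DualModel E F) (p t)}
    (h : HasMFDerivWithinAt 𝓘(ℝ, ℝ) (DualModel E F) p J t
      (ContinuousLinearMap.smulRight (1 : ℝ →L[ℝ] ℝ) w)) (X : Sec E F A) :
    HasDerivWithinAt (fun s => pair (p s).2 (X (p s).proj)) (dPhi (p t) X 0 w) J t := by
  rw [← dH_Phi]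
  have h1 := ((Phi (E := E) X).contMDiff.mdifferentiable (by simp) (p t)).hasMFDerivAt
  exact hasDerivWithinAt_comp_curve h1.hasMFDerivWithinAt (S := univ) h (mapsTo_univ _ _)

namespace LieAlgebroid
variable (L : LieAlgebroid E F A)
  (N : CovariantDerivative 𝓘(ℝ, E) F A) [CovariantDerivative.ContMDiffCovariantDerivative N ∞]

/-- The Lie–Poisson bracket in terms of the `A`-connection `∇̄` and the horizontal part of a
covector. -/
theorem bracketForm_eq_hor_sub_bar (p : DualTot F A) (X Y : Sec E F A) (g : Fn E Q) :
    L.bracketForm p X 0 Y g = pair (L.anchorDual p.proj (hor N p (dPhi p Y g))) (X p.proj) -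
      pair p.2 ((L.bar N).toFun Y X p.proj) := by
  have h0 : dirDeriv (L.anchor p.proj (Y p.proj)) (0 : Fn E Q) = 0 := dirDeriv_const _ 0
  have h1 : pair (L.anchorDual p.proj (hor N p (dPhi p Y g))) (X p.proj) =
      pair p.2 (N Y p.proj (L.anchor p.proj (X p.proj))) +
        dirDeriv (L.anchor p.proj (X p.proj)) g := hor_dPhi N p Y g _
  have h2 : pair p.2 ((L.bar N).toFun Y X p.proj) =
      pair p.2 (N Y p.proj (L.anchor p.proj (X p.proj))) + pair p.2 (L.bracket Y X p.proj) :=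
    map_add p.2 _ _
  have h3 : pair p.2 (L.bracket X Y p.proj) = -pair p.2 (L.bracket Y X p.proj) := by
    rw [L.bracket_swap]
    exact map_neg p.2 _
  rw [bracketForm, h0, h1, h2, h3]
  -- The term `⟨p, ∇_{ρ(X)} Y⟩` occurs both in the horizontal part and in `∇̄_Y X` and cancels; what
  -- remains agrees by antisymmetry of the bracket.
  ring

/-- Along a curve whose base path satisfies the anchor equation, the linear part of Hamilton's
equation says that the covariant derivative is the horizontal force. -/
theorem isCovDerivAlong_bar_dual_iff (ε : ℝ) {H : C^∞⟮DualModel E F, DualTot F A; ℝ⟯}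
    {J : Set ℝ} {p : ℝ → DualTot F A} (hp : ContMDiffOn 𝓘(ℝ, ℝ) (DualModel E F) 1 p J)
    {t : ℝ} (hJ : UniqueDiffWithinAt ℝ J t) (ht : t ∈ J) {w : TangentSpace (DualModel E F) (p t)}
    (hw : HasMFDerivWithinAt 𝓘(ℝ, ℝ) (DualModel E F) p J t
      (ContinuousLinearMap.smulRight (1 : ℝ →L[ℝ] ℝ) w))
    {Y : Sec E F A} {g : Fn E Q} (hH : dPhi (p t) Y g = dH H (p t))
    (hq : HasMFDerivWithinAt 𝓘(ℝ, ℝ) 𝓘(ℝ, E) (fun s => (p s).proj) J t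
      (ContinuousLinearMap.smulRight (1 : ℝ →L[ℝ] ℝ)
        (L.anchor (p t).proj (-(ε • ver (p t) (dH H (p t))))))) :
    (L.bar N).dual.IsCovDerivAlong J (fun t => (p t).proj)
        (fun t => -(ε • ver (p t) (dH H (p t)))) (fun t => (p t).2) t
        (ε • L.anchorDual (p t).proj (hor N (p t) (dH H (p t)))) ↔
      ∀ X : Sec E F A, dPhi (p t) X 0 w = ε * L.bracketForm (p t) X 0 Y g := by
  -- At time `t` the section `-ε Y` passes through `a(t)`, so it can stand for `a` in the product
  -- rule.
  have hY : (-(ε • Y)) (p t).proj = -(ε • ver (p t) (dH H (p t))) := by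
    rw [← hH, ver_dPhi]; rfl
  have hbar : ∀ X : Sec E F A, pair (p t).2 ((L.bar N).toFun (-(ε • Y)) X (p t).proj) =
      -(ε * pair (p t).2 ((L.bar N).toFun Y X (p t).proj)) := fun X => by
    rw [map_neg, map_smul]
    exact (map_neg (p t).2 _).trans (congrArg Neg.neg (map_smul (p t).2 ε _))
  have hpair : ∀ X : Sec E F A,
      pair (ε • L.anchorDual (p t).proj (hor N (p t) (dH H (p t)))) (X (p t).proj) =
      ε * pair (L.anchorDual (p t).proj (hor N (p t) (dH H (p t)))) (X (p t).proj) :=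
    fun X => rfl
  constructor
  · intro h X
    have h1 := h.hasDerivWithinAt_pair hJ ht hq hY X
    -- The derivative of `⟨p, X(q)⟩` is computed once from the velocity `w` and once by the product
    -- rule; both values agree.
    rw [hJ.eq_deriv _ (hasDerivWithinAt_Phi_curve hw X) h1, hbar, hpair,
      bracketForm_eq_hor_sub_bar L N, hH]
    ring
  · intro h
    -- Some covariant derivative `w'` exists because `p` is `C¹`; comparing the two derivatives of
    -- `⟨p, X(q)⟩` for every `X` then forces `w'` to be the prescribed covector.
    obtain ⟨w', hw'⟩ := AConnection.IsCovDerivAlong.of_extension (L.bar N).dual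
      (q := fun t => (p t).proj) (fun t => -(ε • ver (p t) (dH H (p t))))
      (u := fun t => (p t).2) ht (hp t ht)
    convert hw' using 1
    refine dual_ext (E := E) (G := F) fun X => ?_
    have h1 := hw'.hasDerivWithinAt_pair hJ ht hq hY X
    have h2 := hJ.eq_deriv _ (hasDerivWithinAt_Phi_curve hw X) h1
    rw [h, hbar, bracketForm_eq_hor_sub_bar L N, hH] at h2
    rw [hpair]
    linarith

/-- Hamilton's equation at one time, for a `C¹` curve in `A*`. -/
theorem hasMFDerivWithinAt_hamiltonianVF_iff (ε : ℝ) {H : C^∞⟮DualModel E F, DualTot F A; ℝ⟯}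
    {J : Set ℝ} {p : ℝ → DualTot F A} (hp : ContMDiffOn 𝓘(ℝ, ℝ) (DualModel E F) 1 p J)
    {t : ℝ} (hJ : UniqueDiffWithinAt ℝ J t) (ht : t ∈ J) :
    HasMFDerivWithinAt 𝓘(ℝ, ℝ) (DualModel E F) p J t
        (ContinuousLinearMap.smulRight (1 : ℝ →L[ℝ] ℝ) (L.hamiltonianVF ε H (p t))) ↔
      HasMFDerivWithinAt 𝓘(ℝ, ℝ) 𝓘(ℝ, E) (fun s => (p s).proj) J t
        (ContinuousLinearMap.smulRight (1 : ℝ →L[ℝ] ℝ)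
          (L.anchor (p t).proj (-(ε • ver (p t) (dH H (p t)))))) ∧
      (L.bar N).dual.IsCovDerivAlong J (fun t => (p t).proj)
        (fun t => -(ε • ver (p t) (dH H (p t)))) (fun t => (p t).2) t
        (ε • L.anchorDual (p t).proj (hor N (p t) (dH H (p t)))) := by
  obtain ⟨w, hw⟩ : ∃ w : TangentSpace (DualModel E F) (p t),
      HasMFDerivWithinAt 𝓘(ℝ, ℝ) (DualModel E F) p J t
        (ContinuousLinearMap.smulRight (1 : ℝ →L[ℝ] ℝ) w) := by
    have h := ((hp t ht).mdifferentiableWithinAt (by simp)).hasMFDerivWithinAt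
    refine ⟨mfderivWithin 𝓘(ℝ, ℝ) (DualModel E F) p J t (1 : ℝ), h.congr_mfderiv ?_⟩
    exact ContinuousLinearMap.ext_ring (one_smul ℝ _).symm
  -- The pair `(Y, g)` represents `dH` at the single point `p t`; it need not do so at other times,
  -- and everything below is an identity at time `t`.
  have hH := dPhi_rep (p t) (dH H (p t))
  have hu : UniqueMDiffWithinAt 𝓘(ℝ, ℝ) J t := hJ.uniqueMDiffWithinAt
  have hq := hasMFDerivWithinAt_proj_curve hw
  have key := L.eq_hamiltonianVF_iff ε H (p t) _ _ hH w
  constructor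
  · intro h
    obtain ⟨h1, h2⟩ := key.1 (smulRight_one_injective _ (hu.eq hw h))
    rw [h1] at hq
    exact ⟨hq, (L.isCovDerivAlong_bar_dual_iff N ε hp hJ ht hw hH hq).2 h2⟩
  · rintro ⟨h1, h2⟩
    -- The velocity of the base path is both the projection of `w` and `ρ(a)`; by uniqueness they
    -- coincide, so `w` meets both conditions characterizing the Hamiltonian vector.
    rw [← key.2 ⟨smulRight_one_injective _ (hu.eq hq h1),
      (L.isCovDerivAlong_bar_dual_iff N ε hp hJ ht hw hH h1).1 h2⟩]
    exact hw

end LieAlgebroid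
end Equation

end LiePoisson

end

/-- The sign `±` is encoded as `ε`, so `∓ dH^ver` reads `-(ε • ver …)`. Being an integral curve,
being an `A`-path and satisfying the covariant equation are each conditions at every `t ∈ J`, so the
equivalence at one time suffices. -/
theorem mainTheorem1
    {E : Type*} [NormedAddCommGroup E] [NormedSpace ℝ E] [FiniteDimensional ℝ E]
    {Q : Type*} [TopologicalSpace Q] [ChartedSpace E Q] [IsManifold 𝓘(ℝ, E) ∞ Q] [T2Space Q]
    {F : Type*} [NormedAddCommGroup F] [NormedSpace ℝ F] [FiniteDimensional ℝ F]
    {A : Q → Type*} [TopologicalSpace (TotalSpace F A)]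
    [∀ q, AddCommGroup (A q)] [∀ q, Module ℝ (A q)] [∀ q, TopologicalSpace (A q)]
    [∀ q, IsTopologicalAddGroup (A q)] [∀ q, ContinuousSMul ℝ (A q)]
    [FiberBundle F A] [VectorBundle ℝ F A] [ContMDiffVectorBundle ∞ F A 𝓘(ℝ, E)]
    (L : LiePoisson.LieAlgebroid E F A)
    (N : CovariantDerivative 𝓘(ℝ, E) F A)
    [CovariantDerivative.ContMDiffCovariantDerivative N ∞]
    (H : C^∞⟮LiePoisson.DualModel E F, LiePoisson.DualTot F A; ℝ⟯)
    (ε : ℝ) (hε : ε = 1 ∨ ε = -1)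
    (J : Set ℝ) (hJ : J.OrdConnected) (hJ' : J.Nontrivial)
    (p : ℝ → LiePoisson.DualTot F A)
    (hp : ContMDiffOn 𝓘(ℝ, ℝ) (LiePoisson.DualModel E F) 1 p J) :
    IsMIntegralCurveOn p (L.hamiltonianVF ε H) J ↔
      L.IsAPath J (fun t => (p t).proj)
        (fun t => -(ε • LiePoisson.ver (p t) (LiePoisson.dH H (p t)))) ∧
      ∀ t ∈ J, (L.bar N).dual.IsCovDerivAlong J (fun t => (p t).proj)
        (fun t => -(ε • LiePoisson.ver (p t) (LiePoisson.dH H (p t)))) (fun t => (p t).2) t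
        (ε • L.anchorDual (p t).proj
          (LiePoisson.hor N (p t) (LiePoisson.dH H (p t)))) := by
  have hJd := LiePoisson.uniqueDiffOn_of_ordConnected hJ hJ'
  have key := fun t (ht : t ∈ J) =>
    L.hasMFDerivWithinAt_hamiltonianVF_iff N ε (H := H) hp (hJd t ht) ht
  exact ⟨fun h => ⟨fun t ht => ((key t ht).1 (h t ht)).1, fun t ht => ((key t ht).1 (h t ht)).2⟩,
    fun h t ht => (key t ht).2 ⟨h.1 t ht, h.2 t ht⟩⟩
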